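/- Let $\mathbb S^2\subset\mathbb R^3$ be the unit sphere with area measure $\nu$ ($\nu(\mathbb S^2)=4\pi$). Let $T_0=\{T_0(x):x\in\mathbb S^2\}$ be a real-valued measurable Gaussian random field with $\mathbb E[T_0(x)]=0$ and $\mathbb E[T_0(x)^2]=1$ for all $x$, which is isotropic: $\mathbb E[T_0(x)T_0(y)]=\mathbb E[T_0(gx)T_0(gy)]$ for all $g\in SO(3)$ and $x,y\in\mathbb S^2$. (A random field on $\mathbb S^2$ is called measurable if, outside a null event, it coincides at all points of the sphere with a field that is jointly measurable in the point and in $\omega$.) Let $(C_\ell)_{\ell\ge 0}$ be its angular power spectrum, i.e. $\mathbb E[a_{\ell m}\overline{a_{\ell' m'}}]=\delta_{\ell\ell'}\delta_{mm'}C_\ell$ for $a_{\ell m}=\int_{\mathbb S^2}T_0\,\overline{Y_{\ell m}}\,d\nu$, where $\{Y_{\ell m}:-\ell\le m\le\ell\}$ is an orthonormal basis, in $L^2(\mathbb S^2,\nu)$, of the complex spherical harmonics of degree $\ell$ (the restrictions to $\mathbb S^2$ of homogeneous harmonic polynomials of degree $\ell$). Assume that there are $\alpha$ with $2<\alpha<4$,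 a constant $K_0\ge 1$ and a function $G$ such that $$C_\ell=G(\ell)\,\ell^{-\alpha},\qquad K_0^{-1}\le G(\ell)\le K_0\qquad\text{for all }\ell=1,2,\dots$$ Let $\mathbf T(x)=(T_1(x),\dots,T_d(x))$, $x\in\mathbb S^2$, where $T_1,\dots,T_d$ are independent copies of $T_0$ defined on one probability space, each of them a measurable random field, and assume $\beta=4-(\alpha-2)d>0$. Then almost surely the range $\mathbf T(\mathbb S^2)=\{\mathbf T(x):x\in\mathbb S^2\}\subset\mathbb R^d$ is Lebesgue measurable and has positive Lebesgue measure. -/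

import Mathlib

open MeasureTheory ProbabilityTheory Set

noncomputable section

namespace SphericalField

/-- The unit sphere `𝕊²` of `ℝ³`. -/
abbrev S2 : Type := Metric.sphere (0 : EuclideanSpace ℝ (Fin 3)) 1

/-- The canonical area measure `ν` on `𝕊²` (total mass `4π`). -/
def areaMeasure : Measure S2 :=
  (volume : Measure (EuclideanSpace ℝ (Fin 3))).toSphere

/-- The action on `𝕊²` of a linear isometry of `ℝ³`. -/
def rotate (g : EuclideanSpace ℝ (Fin 3) ≃ₗᵢ[ℝ] EuclideanSpace ℝ (Fin 3)) (x : S2) : S2 :=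
  ⟨g x.1, by
    have hx := x.2
    rw [mem_sphere_zero_iff_norm] at hx ⊢
    rw [g.norm_map, hx]⟩

/-- The Laplacian of a complex polynomial in three variables. -/
def laplacian (p : MvPolynomial (Fin 3) ℂ) : MvPolynomial (Fin 3) ℂ :=
  ∑ i, MvPolynomial.pderiv i (MvPolynomial.pderiv i p)

/-- `Y` is a (complex) spherical harmonic of degree `ℓ`: the restriction to `𝕊²` of a homogeneous
harmonic polynomial of degree `ℓ`. -/
def IsSphericalHarmonic (ℓ : ℕ) (Y : S2 → ℂ) : Prop :=
  ∃ p : MvPolynomial (Fin 3) ℂ, p.IsHomogeneous ℓ ∧ laplacian p = 0 ∧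
    ∀ x : S2, Y x = MvPolynomial.eval (fun i => ((x.1 i : ℝ) : ℂ)) p

variable {Ω : Type*} [MeasurableSpace Ω]

/-- A measurable random field on `𝕊²`: up to a null set of `ω`'s (the same for all points of the
sphere), it is jointly measurable in the point of the sphere and in `ω`. -/
def IsMeasurableField {E : Type*} [MeasurableSpace E] (T : S2 → Ω → E) (P : Measure Ω) : Prop :=
  ∃ S : S2 → Ω → E, Measurable (fun q : S2 × Ω => S q.1 q.2) ∧ ∀ᵐ ω ∂P, ∀ x, T x ω = S x ω

/-- The covariance of a zero-mean field is invariant under `SO(3)`. -/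
def IsIsotropic (T : S2 → Ω → ℝ) (P : Measure Ω) : Prop :=
  ∀ g : EuclideanSpace ℝ (Fin 3) ≃ₗᵢ[ℝ] EuclideanSpace ℝ (Fin 3),
    LinearMap.det (g.toLinearEquiv : EuclideanSpace ℝ (Fin 3) →ₗ[ℝ] EuclideanSpace ℝ (Fin 3)) = 1 →
    ∀ x y : S2, ∫ ω, T x ω * T y ω ∂P = ∫ ω, T (rotate g x) ω * T (rotate g y) ω ∂P

/-- The random harmonic coefficient `a(Y) = ∫ T(x) conj (Y(x)) dν(x)`. -/
def coeff (T : S2 → Ω → ℝ) (Y : S2 → ℂ) (ω : Ω) : ℂ :=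
  ∫ x, (T x ω : ℂ) * (starRingEnd ℂ) (Y x) ∂areaMeasure

/-- `C` is the angular power spectrum of the zero-mean isotropic field `T`:
`E[a_{ℓm} conj a_{ℓ'm'}] = δ_{ℓℓ'} δ_{mm'} C_ℓ` for the coefficients `a_{ℓm} = a(Y_{ℓm})` in an
orthonormal basis `(Y_{ℓm})` of spherical harmonics. The relation is written without a choice of
basis: both sides are sesquilinear in `(Y, Y')`, and `⟪Y, Y'⟫ = δ_{ℓℓ'} δ_{mm'}` on a basis. -/
def IsAngularPowerSpectrum (T : S2 → Ω → ℝ) (P : Measure Ω) (C : ℕ → ℝ) : Prop :=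
  ∀ (ℓ ℓ' : ℕ) (Y Y' : S2 → ℂ), IsSphericalHarmonic ℓ Y → IsSphericalHarmonic ℓ' Y' →
    ∫ ω, coeff T Y ω * (starRingEnd ℂ) (coeff T Y' ω) ∂P =
      if ℓ = ℓ' then (C ℓ : ℂ) * ∫ x, (starRingEnd ℂ) (Y x) * Y' x ∂areaMeasure else 0

/-- Condition (A) with exponent `α`: a zero-mean, unit-variance, isotropic Gaussian random field on
`𝕊²` with angular power spectrum `C_ℓ = G(ℓ) ℓ^{-α}`, where `α > 2` and `K₀⁻¹ ≤ G ≤ K₀`. -/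
structure ConditionA (T : S2 → Ω → ℝ) (P : Measure Ω) (α : ℝ) : Prop where
  measurable : IsMeasurableField T P
  gaussian : IsGaussianProcess T P
  mean_zero : ∀ x, ∫ ω, T x ω ∂P = 0
  isotropic : IsIsotropic T P
  unit_variance : ∀ x, ∫ ω, T x ω ^ 2 ∂P = 1
  two_lt : 2 < α
  spectrum : ∃ C : ℕ → ℝ, IsAngularPowerSpectrum T P C ∧
    ∃ (G : ℕ → ℝ) (K₀ : ℝ), 1 ≤ K₀ ∧
      ∀ ℓ : ℕ, 1 ≤ ℓ → K₀⁻¹ ≤ G ℓ ∧ G ℓ ≤ K₀ ∧ C ℓ = G ℓ * (ℓ : ℝ) ^ (-α)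

/-- The components `T 0, …, T (d-1)` are independent copies of the field `T₀`: as random elements
of the path space `ℝ^{𝕊²}` (product σ-algebra) they are independent and have the law of `T₀`. -/
structure AreIndependentCopies {Ω₀ : Type*} [MeasurableSpace Ω₀] {d : ℕ}
    (T : Fin d → S2 → Ω → ℝ) (P : Measure Ω) (T₀ : S2 → Ω₀ → ℝ) (P₀ : Measure Ω₀) : Prop where
  measurable : ∀ i, IsMeasurableField (T i) P
  indep : iIndepFun (fun i ω x => T i x ω) P
  identDistrib : ∀ i, IdentDistrib (fun ω x => T i x ω) (fun ω x => T₀ x ω) P P₀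

/-- The vector-valued field `𝐓(x) = (T₁(x), …, T_d(x))`. -/
def vectorField {d : ℕ} (T : Fin d → S2 → Ω → ℝ) (x : S2) (ω : Ω) : EuclideanSpace ℝ (Fin d) :=
  WithLp.toLp 2 (fun i => T i x ω)

end SphericalField

end

/-! Fix `ω` and push the area measure `ν` forward by the path `x ↦ T(x)`; this is the occupation
measure. Its lower density at `T(x)` is, up to a constant, the liminf of `ε^{-d} ν{y : |T(x) - T(y)|
≤ ε}` along `ε = 1/(n+1)`. If the range were Lebesgue null, Lebesgue measure and the occupation
measure would be mutually singular, and Besicovitch differentiation would make this density infinite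
at `T(x)` for almost every `x`. So finiteness of the liminf suffices
(`measure_range_pos_of_liminf_lt_top`). By Fubini and Fatou it holds almost surely once `P(|T(x) -
T(y)| ≤ ε) ≤ ε^d g(x, y)` with `g` integrable on pairs of points
(`ae_measure_range_pos_of_smallBall`). Neither continuous paths nor local times are involved.

For independent Gaussian components `g` may be the power `-d/2` of a lower bound for the variance of
an increment of `T₀`. The required bound is `Var(T₀(x) - T₀(y)) ≥ c |x - y|^{α-2}`: then `g` is of
order `|x - y|^{-(α-2)d/2}`, which is integrable on a two-dimensional sphere because `(α-2)d/2 < 2`,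
that is `β > 0`.

The variance bound (`exists_rpow_le_two_sub`) is spectral. Isotropy makes the covariance a function
of `⟪x, y⟫`; by the Funk-Hecke formula zonal harmonics are eigenfunctions of the covariance
operator, with eigenvalues `C_ℓ`. Projecting the increment to finitely many degrees bounds its
variance below by partial sums of `∑ C_ℓ (2ℓ+1)/(4π) · 2(1 - P_ℓ⟪x, y⟫)`; as in Bessel's inequality,
the series need not converge to the variance. Each degree up to order `1/|x - y|` contributes at
least a multiple of `ℓ^{1-α} · ℓ²|x - y|²`, and since `α < 4` these terms add up to order `|x -
y|^{α-2}`.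

Measurability of the range is separate: a Borel image of the sphere is analytic, and analytic sets
are universally measurable. -/

open scoped ENNReal

/-! ### Universal measurability of analytic sets -/

/-- If a set has outer measure above `c`, so has a set of sequences bounded by a fixed sequence,
as far as finitely many coordinates are concerned. -/
theorem exists_bound_forall_lt_measure_image {X : Type*} [MeasurableSpace X] {μ : Measure X}
    (f : (ℕ → ℕ) → X) {c : ℝ≥0∞} (hc : c < μ (range f)) :
    ∃ l : ℕ → ℕ, ∀ k, c < μ (f '' {x | ∀ i < k, x i ≤ l i}) := by
  have step : ∀ (k : ℕ) (A : {A : Set (ℕ → ℕ) // c < μ (f '' A)}),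
      ∃ m : ℕ, c < μ (f '' (A.1 ∩ {x | x k ≤ m})) := by
    rintro k ⟨A, hA⟩
    have hU : f '' A = ⋃ m : ℕ, f '' (A ∩ {x | x k ≤ m}) := by
      rw [← image_iUnion, ← inter_iUnion]
      congr 1
      refine (inter_eq_left.2 fun x _ => mem_iUnion.2 ⟨x k, le_refl (x k)⟩).symm
    have hmono : Monotone fun m : ℕ => f '' (A ∩ {x | x k ≤ m}) := fun a b hab =>
      image_mono (inter_subset_inter_right _ fun x (hx : x k ≤ a) => hx.trans hab)
    -- Continuity from below holds for increasing unions of arbitrary sets, so the images need not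
    -- be known to be measurable.
    rw [hU, hmono.measure_iUnion] at hA
    exact lt_iSup_iff.1 hA
  choose m hm using step
  let A : ℕ → {A : Set (ℕ → ℕ) // c < μ (f '' A)} := fun k =>
    Nat.rec ⟨univ, by rwa [image_univ]⟩ (fun k B => ⟨B.1 ∩ {x | x k ≤ m k B}, hm k B⟩) k
  refine ⟨fun k => m k (A k), fun k => ?_⟩
  have hA : ∀ k, (A k).1 = {x | ∀ i < k, x i ≤ m i (A i)} := by
    intro k
    induction k with
    | zero => ext x; simp [A]
    | succ k ih =>
      have : (A (k + 1)).1 = (A k).1 ∩ {x | x k ≤ m k (A k)} := rfl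
      rw [this, ih]
      ext x
      simp only [mem_inter_iff, mem_ofPred_eq, Nat.lt_succ_iff_lt_or_eq, or_imp, forall_and,
        forall_eq]
  rw [← hA k]
  exact (A k).2

/-- Sequences bounded by `l` in sufficiently many coordinates lie in a given open neighbourhood of
the compact set of all sequences bounded by `l`. -/
theorem exists_setOf_forall_lt_le_subset (l : ℕ → ℕ) {U : Set (ℕ → ℕ)} (hU : IsOpen U)
    (hl : {x | ∀ i, x i ≤ l i} ⊆ U) : ∃ k, {x : ℕ → ℕ | ∀ i < k, x i ≤ l i} ⊆ U := by
  have hK : IsCompact {x : ℕ → ℕ | ∀ i, x i ≤ l i} := by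
    have h := isCompact_univ_pi fun i => (Set.finite_Iic (l i)).isCompact
    convert h using 1
    ext x
    simp [Pi.le_def]
  let := PiNat.metricSpaceNatNat
  obtain ⟨δ, hδ, hsub⟩ := hK.exists_thickening_subset_open hU hl
  obtain ⟨k, hk⟩ := exists_pow_lt_of_lt_one hδ (by norm_num : (1 / 2 : ℝ) < 1)
  -- The nearby point of the box is the truncation of `x` by `l`: it agrees with `x` in the first
  -- `k` coordinates, hence lies within `(1/2)^k` of it.
  refine ⟨k, fun x hx => hsub (Metric.mem_thickening_iff.2
    ⟨fun i => min (x i) (l i), fun i => min_le_right _ _, lt_of_le_of_lt ?_ hk⟩)⟩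
  refine PiNat.mem_cylinder_iff_dist_le.1 (PiNat.mem_cylinder_iff.2 fun i hi => ?_)
  exact (min_eq_left (hx i hi)).symm

/-- The compact set is the image of a box of bounded sequences. Were its measure below `c`, an open
neighbourhood would also have measure below `c`; its preimage would contain a set constrained in
finitely many coordinates only, whose image has measure above `c`. -/
theorem exists_isCompact_image_le_measure {X : Type*} [TopologicalSpace X] [MeasurableSpace X]
    {μ : Measure X} [μ.OuterRegular] {f : (ℕ → ℕ) → X} (hf : Continuous f) {c : ℝ≥0∞}
    (hc : c < μ (range f)) : ∃ K ⊆ range f, IsCompact K ∧ c ≤ μ K := by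
  obtain ⟨l, hl⟩ := exists_bound_forall_lt_measure_image f hc
  have hK : IsCompact {x : ℕ → ℕ | ∀ i, x i ≤ l i} := by
    have h := isCompact_univ_pi fun i => (Set.finite_Iic (l i)).isCompact
    convert h using 1
    ext x
    simp [Pi.le_def]
  refine ⟨f '' {x | ∀ i, x i ≤ l i}, image_subset_range _ _, hK.image hf, ?_⟩
  by_contra! h
  obtain ⟨V, hV, hVo, hVc⟩ := Set.exists_isOpen_lt_of_lt _ _ h
  obtain ⟨k, hk⟩ := exists_setOf_forall_lt_le_subset l (hVo.preimage hf) (image_subset_iff.1 hV)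
  exact absurd ((hl k).trans_le (measure_mono (image_subset_iff.2 hk))) hVc.not_gt

/-- Analytic sets are universally measurable. -/
theorem MeasureTheory.AnalyticSet.nullMeasurableSet {X : Type*} [TopologicalSpace X] [T2Space X]
    [TopologicalSpace.PseudoMetrizableSpace X] [MeasurableSpace X] [BorelSpace X] {s : Set X}
    (hs : AnalyticSet s) (μ : Measure X) [SFinite μ] : NullMeasurableSet s μ := by
  -- Null measurability depends only on the null sets; finiteness of the measure lets equality of
  -- measures imply equality almost everywhere.
  suffices h : NullMeasurableSet s μ.toFinite from h.mono_ac (absolutelyContinuous_toFinite μ)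
  rw [AnalyticSet] at hs
  obtain rfl | ⟨f, hf, rfl⟩ := hs
  · exact MeasurableSet.empty.nullMeasurableSet
  set ν := μ.toFinite
  rcases eq_or_ne (ν (range f)) 0 with h0 | h0
  · exact NullMeasurableSet.of_null h0
  obtain ⟨u, -, hu, hlim⟩ := exists_seq_strictMono_tendsto' (pos_iff_ne_zero.2 h0)
  choose K hKs hKc hK using fun n => exists_isCompact_image_le_measure hf (hu n).2
  have hle : ν (range f) ≤ ν (⋃ n, K n) :=
    le_of_tendsto' hlim fun n => (hK n).trans (measure_mono (subset_iUnion K n))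
  have hKm : MeasurableSet (⋃ n, K n) := .iUnion fun n => (hKc n).measurableSet
  have hsub : ⋃ n, K n ⊆ range f := iUnion_subset hKs
  have hae : (⋃ n, K n) =ᵐ[ν] range f :=
    ae_eq_of_subset_of_measure_ge hsub hle hKm.nullMeasurableSet (measure_ne_top _ _)
  exact hKm.nullMeasurableSet.congr hae

theorem nullMeasurableSet_range_of_measurable {X Y : Type*} [MeasurableSpace X]
    [StandardBorelSpace X] [TopologicalSpace Y] [T2Space Y] [SecondCountableTopology Y]
    [TopologicalSpace.PseudoMetrizableSpace Y] [MeasurableSpace Y] [BorelSpace Y] {f : X → Y}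
    (hf : Measurable f) (μ : Measure Y) [SFinite μ] : NullMeasurableSet (range f) μ := by
  rw [← image_univ]
  exact (MeasurableSet.univ.analyticSet_image hf).nullMeasurableSet μ

/-! ### Occupation densities and ranges of positive measure -/

/-- If the occupation measure of `f` has a finite lower density at the values of `f`, then the
range of `f` is not Lebesgue null. -/
theorem measure_range_pos_of_liminf_lt_top {X E : Type*} [MeasurableSpace X] {ν : Measure X}
    [IsFiniteMeasure ν] [NeZero ν] [NormedAddCommGroup E] [NormedSpace ℝ E] [FiniteDimensional ℝ E]
    [MeasurableSpace E] [BorelSpace E] (lam : Measure E) [lam.IsAddHaarMeasure]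
    {f : X → E} (hf : Measurable f)
    (h : ∀ᵐ x ∂ν, Filter.liminf (fun n : ℕ => ν {y | ‖f x - f y‖ ≤ 1 / ((n : ℝ) + 1)} /
      ENNReal.ofReal ((1 / ((n : ℝ) + 1)) ^ Module.finrank ℝ E)) Filter.atTop < ∞) :
    0 < lam (range f) := by
  rw [pos_iff_ne_zero]
  intro h0
  have hsing : lam ⟂ₘ ν.map f := by
    refine ⟨toMeasurable lam (range f), measurableSet_toMeasurable _ _, by
      rwa [measure_toMeasurable], ?_⟩
    rw [Measure.map_apply hf (measurableSet_toMeasurable _ _).compl]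
    convert measure_empty (μ := ν)
    rw [preimage_compl, compl_empty_iff, eq_univ_iff_forall]
    exact fun x => subset_toMeasurable _ _ (mem_range_self x)
  -- `lam` is differentiated with respect to the occupation measure, not conversely: the derivative
  -- vanishes at almost all values of `f`, so the inverse ratio, the occupation density, tends to
  -- infinity there.
  have hball : ∀ᵐ z ∂(ν.map f), Filter.Tendsto (fun r => lam (Metric.closedBall z r) /
      (ν.map f) (Metric.closedBall z r)) (nhdsWithin 0 (Ioi 0)) (nhds 0) := by
    filter_upwards [Besicovitch.ae_tendsto_rnDeriv lam (ν.map f), hsing.rnDeriv_ae_eq_zero]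
      with z hz hz0
    simpa [hz0] using hz
  have hball' := ae_of_ae_map hf.aemeasurable hball
  obtain ⟨x, hx, hxl⟩ := (hball'.and h).exists
  have hseq : Filter.Tendsto (fun n : ℕ => (1 / ((n : ℝ) + 1))) Filter.atTop
      (nhdsWithin 0 (Ioi 0)) :=
    tendsto_nhdsWithin_iff.2 ⟨tendsto_one_div_add_atTop_nhds_zero_nat,
      .of_forall fun n => by simp only [mem_Ioi]; positivity⟩
  have hlim := hx.comp hseq
  set c := lam (Metric.ball 0 1) with hc
  have hc0 : c ≠ 0 := (Metric.measure_ball_pos lam 0 one_pos).ne'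
  have hct : c ≠ ∞ := measure_ball_lt_top.ne
  have hinv := tendsto_inv_iff.2 hlim
  have hmul : Filter.Tendsto (fun n : ℕ => ν {y | ‖f x - f y‖ ≤ 1 / ((n : ℝ) + 1)} /
      ENNReal.ofReal ((1 / ((n : ℝ) + 1)) ^ Module.finrank ℝ E)) Filter.atTop (nhds ∞) := by
    have := ENNReal.Tendsto.const_mul (a := c) hinv (Or.inl (by simp))
    rw [ENNReal.inv_zero, ENNReal.mul_top hc0] at this
    refine this.congr fun n => ?_
    have hn : (0 : ℝ) < 1 / ((n : ℝ) + 1) := by positivity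
    have hset : f ⁻¹' Metric.closedBall (f x) (1 / ((n : ℝ) + 1)) =
        {y | ‖f x - f y‖ ≤ 1 / ((n : ℝ) + 1)} := by
      ext y
      simp [dist_eq_norm, norm_sub_rev (f y)]
    simp only [Function.comp_apply]
    rw [Measure.map_apply hf Metric.isClosed_closedBall.measurableSet, hset,
      Measure.addHaar_closedBall lam _ hn.le, ← hc, ENNReal.inv_div (Or.inl (measure_ne_top _ _))
        (Or.inr (mul_ne_zero (ENNReal.ofReal_pos.2 (by positivity)).ne' hc0)),
      mul_comm (ENNReal.ofReal _) c]
    rw [div_eq_mul_inv, ENNReal.mul_inv (Or.inl hc0) (Or.inl hct), ← mul_assoc, mul_comm c,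
      mul_assoc (ν _), ENNReal.mul_inv_cancel_left hc0 hct]
    rfl
  rw [hmul.liminf_eq] at hxl
  exact lt_irrefl _ hxl

/-- A random field whose increments satisfy an integrable small-ball estimate almost surely has a
range of positive Lebesgue measure. -/
theorem ae_measure_range_pos_of_smallBall {X Ω E : Type*} [MeasurableSpace X] [MeasurableSpace Ω]
    {ν : Measure X} [IsFiniteMeasure ν] [NeZero ν] {P : Measure Ω} [IsProbabilityMeasure P]
    [NormedAddCommGroup E] [NormedSpace ℝ E] [FiniteDimensional ℝ E]
    [MeasurableSpace E] [BorelSpace E] (lam : Measure E) [lam.IsAddHaarMeasure]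
    {S : X → Ω → E} (hS : Measurable fun q : X × Ω => S q.1 q.2) {g : X × X → ℝ≥0∞}
    (hgm : Measurable g) (hg : ∫⁻ q, g q ∂(ν.prod ν) ≠ ∞)
    (hsb : ∀ᵐ q ∂(ν.prod ν), ∀ ε : ℝ, 0 < ε →
      P {ω | ‖S q.1 ω - S q.2 ω‖ ≤ ε} ≤ ENNReal.ofReal (ε ^ Module.finrank ℝ E) * g q) :
    ∀ᵐ ω ∂P, 0 < lam (range fun x => S x ω) := by
  have : ProperSpace E := FiniteDimensional.proper ℝ E
  let A : ℕ → Set ((Ω × X) × X) := fun n =>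
    {p | ‖S p.1.2 p.1.1 - S p.2 p.1.1‖ ≤ 1 / ((n : ℝ) + 1)}
  have hA : ∀ n, MeasurableSet (A n) := fun n => by
    refine measurableSet_le (Measurable.norm (.sub ?_ ?_)) measurable_const
    · exact hS.comp (measurable_fst.snd.prodMk measurable_fst.fst)
    · exact hS.comp (measurable_snd.prodMk measurable_fst.fst)
  let δ : ℕ → ℝ≥0∞ := fun n => ENNReal.ofReal ((1 / ((n : ℝ) + 1)) ^ Module.finrank ℝ E)
  have hδ0 : ∀ n, δ n ≠ 0 := fun n => (ENNReal.ofReal_pos.2 (by positivity)).ne'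
  have hδt : ∀ n, δ n ≠ ∞ := fun n => ENNReal.ofReal_ne_top
  -- The occupation density at scale `1/(n+1)`. Its expectation is bounded by the integral of `g`
  -- uniformly in `n`, which is what Fatou's lemma needs.
  let F : ℕ → Ω × X → ℝ≥0∞ := fun n p => ν (Prod.mk p ⁻¹' A n) / δ n
  have hF : ∀ n, Measurable (F n) := fun n => (measurable_measure_prodMk_left (hA n)).div_const _
  have hFint : ∀ n, ∫⁻ p, F n p ∂(P.prod ν) ≤ ∫⁻ q, g q ∂(ν.prod ν) := by
    intro n
    have h1 : ∫⁻ p, ν (Prod.mk p ⁻¹' A n) ∂(P.prod ν) =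
        ∫⁻ x, ∫⁻ y, P {ω | ‖S x ω - S y ω‖ ≤ 1 / ((n : ℝ) + 1)} ∂ν ∂ν := by
      rw [lintegral_prod_symm _ (measurable_measure_prodMk_left (hA n)).aemeasurable]
      refine lintegral_congr fun x => ?_
      have hB : MeasurableSet {p : Ω × X | ‖S x p.1 - S p.2 p.1‖ ≤ 1 / ((n : ℝ) + 1)} :=
        (measurable_fst.prodMk measurable_const).prodMk measurable_snd (hA n)
      have := (Measure.prod_apply (μ := P) (ν := ν) hB).symm.trans (Measure.prod_apply_symm hB)
      exact this
    have h2 : ∫⁻ x, ∫⁻ y, P {ω | ‖S x ω - S y ω‖ ≤ 1 / ((n : ℝ) + 1)} ∂ν ∂ν ≤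
        ∫⁻ x, ∫⁻ y, δ n * g (x, y) ∂ν ∂ν := by
      refine lintegral_mono_ae ?_
      filter_upwards [Measure.ae_ae_of_ae_prod hsb] with x hx
      refine lintegral_mono_ae ?_
      filter_upwards [hx] with y hy
      exact hy _ (by positivity)
    have h3 : ∫⁻ x, ∫⁻ y, δ n * g (x, y) ∂ν ∂ν = δ n * ∫⁻ q, g q ∂(ν.prod ν) := by
      rw [← lintegral_const_mul _ hgm, lintegral_prod _ (hgm.const_mul _).aemeasurable]
    simp only [F, div_eq_mul_inv]
    rw [lintegral_mul_const _ (measurable_measure_prodMk_left (hA n)), h1]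
    refine (mul_le_mul_left (h2.trans h3.le) _).trans ?_
    rw [mul_comm (δ n), mul_assoc, ENNReal.mul_inv_cancel (hδ0 n) (hδt n), mul_one]
  have hlim : ∫⁻ p, Filter.liminf (fun n => F n p) Filter.atTop ∂(P.prod ν) ≠ ∞ := by
    refine ne_top_of_le_ne_top hg ((lintegral_liminf_le hF).trans ?_)
    refine (Filter.liminf_le_liminf (.of_forall hFint)).trans ?_
    simp
  filter_upwards [Measure.ae_ae_of_ae_prod (ae_lt_top (.liminf hF) hlim)] with ω hω
  exact measure_range_pos_of_liminf_lt_top lam (f := fun x => S x ω)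
    (hS.comp (measurable_id.prodMk measurable_const)) hω

/-! ### Area measure: invariance under isometries and Archimedes' theorem -/

open scoped Pointwise

namespace SphericalField

instance : IsFiniteMeasure areaMeasure := by unfold areaMeasure; infer_instance

instance : NeZero areaMeasure := ⟨Measure.toSphere_ne_zero _⟩

theorem continuous_rotate (g : EuclideanSpace ℝ (Fin 3) ≃ₗᵢ[ℝ] EuclideanSpace ℝ (Fin 3)) :
    Continuous (rotate g) :=
  (g.continuous.comp continuous_subtype_val).subtype_mk _

/-- The area of `s` is a multiple of the volume of the cone over `s`; a linear isometry carries
cones to cones and preserves volume. -/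
theorem measurePreserving_rotate
    (g : EuclideanSpace ℝ (Fin 3) ≃ₗᵢ[ℝ] EuclideanSpace ℝ (Fin 3)) :
    MeasurePreserving (rotate g) areaMeasure areaMeasure := by
  refine ⟨(continuous_rotate g).measurable, Measure.ext fun s hs => ?_⟩
  rw [Measure.map_apply (continuous_rotate g).measurable hs, areaMeasure,
    Measure.toSphere_apply' _ ((continuous_rotate g).measurable hs),
    Measure.toSphere_apply' _ hs]
  congr 1
  have h : Ioo (0 : ℝ) 1 • ((↑) '' (rotate g ⁻¹' s) : Set (EuclideanSpace ℝ (Fin 3))) =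
      g ⁻¹' (Ioo (0 : ℝ) 1 • ((↑) '' s)) := by
    ext x
    simp only [mem_smul, mem_image, mem_preimage, Subtype.exists, exists_and_right, exists_eq_right]
    constructor
    · rintro ⟨r, hr, y, ⟨hy, hys⟩, rfl⟩
      exact ⟨r, hr, g y, ⟨(rotate g ⟨y, hy⟩).2, hys⟩, by simp⟩
    · rintro ⟨r, hr, y, ⟨hy, hys⟩, hxy⟩
      have hy' : ‖y‖ = 1 := by simpa using hy
      refine ⟨r, hr, g.symm y, ⟨by simpa using hy', ?_⟩, ?_⟩
      · convert hys using 1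
        exact Subtype.ext (g.apply_symm_apply y)
      · apply g.injective
        simp [← hxy]
  rw [h]
  exact g.measurePreserving.measure_preimage_equiv (f := g.toHomeomorph.toMeasurableEquiv) _

theorem integral_comp_rotate {F : Type*} [NormedAddCommGroup F] [NormedSpace ℝ F]
    (g : EuclideanSpace ℝ (Fin 3) ≃ₗᵢ[ℝ] EuclideanSpace ℝ (Fin 3)) (f : S2 → F) :
    ∫ x, f (rotate g x) ∂areaMeasure = ∫ x, f x ∂areaMeasure := by
  refine (measurePreserving_rotate g).integral_comp ?_ f
  have hl : Function.LeftInverse (rotate g.symm) (rotate g) := fun x =>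
    Subtype.ext (g.symm_apply_apply x.1)
  have hr : Function.RightInverse (rotate g.symm) (rotate g) := fun x =>
    Subtype.ext (g.apply_symm_apply x.1)
  exact (Homeomorph.mk ⟨rotate g, rotate g.symm, hl, hr⟩ (continuous_rotate g)
    (continuous_rotate g.symm)).measurableEmbedding

/-- Integration in polar coordinates of a function that separates into a radial and an angular
part. -/
theorem integral_polar {f : S2 → ℝ} {h : ℝ → ℝ} {F : EuclideanSpace ℝ (Fin 3) → ℝ}
    (hF : ∀ (x : S2) (r : ℝ), 0 < r → F (r • x.1) = f x * h r) :
    ∫ x, F x = (∫ x, f x ∂areaMeasure) * ∫ r in Ioi (0 : ℝ), r ^ 2 * h r := by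
  set μ : Measure (EuclideanSpace ℝ (Fin 3)) := volume
  calc ∫ x, F x ∂μ = ∫ x : ({(0)}ᶜ : Set (EuclideanSpace ℝ (Fin 3))), F x ∂(μ.comap (↑)) := by
        rw [integral_subtype_comap (measurableSet_singleton _).compl F,
          restrict_compl_singleton]
    _ = ∫ x : S2 × Ioi (0 : ℝ), f x.1 * h x.2 ∂μ.toSphere.prod (.volumeIoiPow 2) := by
        have := μ.measurePreserving_homeomorphUnitSphereProd.integral_comp
          (Homeomorph.measurableEmbedding _) (fun x : S2 × Ioi (0 : ℝ) => f x.1 * h x.2)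
        rw [finrank_euclideanSpace_fin] at this
        rw [← this]
        refine integral_congr_ae (.of_forall fun x => ?_)
        have hx : 0 < ‖(x : EuclideanSpace ℝ (Fin 3))‖ := norm_pos_iff.2 x.2
        have h2 := hF ((homeomorphUnitSphereProd (EuclideanSpace ℝ (Fin 3)) x).1) ‖x.1‖ hx
        simp only [homeomorphUnitSphereProd_apply_snd_coe] at h2 ⊢
        rw [← h2]
        congr 1
        simp [smul_smul, hx.ne']
    _ = (∫ x, f x ∂areaMeasure) * ∫ r : Ioi (0 : ℝ), h r ∂.volumeIoiPow 2 :=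
        integral_prod_mul f (fun r : Ioi (0 : ℝ) => h r)
    _ = _ := by
        congr 1
        simp only [Measure.volumeIoiPow, ENNReal.ofReal]
        rw [integral_withDensity_eq_integral_smul,
          integral_subtype_comap measurableSet_Ioi fun a ↦ Real.toNNReal (a ^ 2) • h a,
          setIntegral_congr_fun measurableSet_Ioi fun x hx ↦ ?_]
        · simp only [NNReal.smul_def, smul_eq_mul]
          rw [Real.coe_toNNReal _ (pow_nonneg hx.out.le _)]
        · exact (measurable_subtype_coe.pow_const _).real_toNNReal

theorem integral_pow_mul_exp_neg_sq_Ioi (n : ℕ) :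
    ∫ r in Ioi (0 : ℝ), r ^ n * Real.exp (-r ^ 2) = 1 / 2 * Real.Gamma (((n : ℝ) + 1) / 2) := by
  have := integral_rpow_mul_exp_neg_rpow (p := 2) (q := n) (by norm_num)
    (by have : (0 : ℝ) ≤ n := n.cast_nonneg
        linarith)
  rw [← this]
  refine setIntegral_congr_fun measurableSet_Ioi fun x _ => ?_
  simp [Real.rpow_natCast]

theorem integral_pow_mul_exp_neg_sq_of_even {n : ℕ} (hn : Even n) :
    ∫ r : ℝ, r ^ n * Real.exp (-r ^ 2) = Real.Gamma (((n : ℝ) + 1) / 2) := by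
  have h := integral_comp_abs (f := fun r : ℝ => r ^ n * Real.exp (-r ^ 2))
  rw [integral_pow_mul_exp_neg_sq_Ioi] at h
  simp only [hn.pow_abs, sq_abs] at h
  rw [h]
  ring

theorem integral_pow_mul_exp_neg_sq_of_odd {n : ℕ} (hn : Odd n) :
    ∫ r : ℝ, r ^ n * Real.exp (-r ^ 2) = 0 := by
  have h := integral_neg_eq_self (fun r : ℝ => r ^ n * Real.exp (-r ^ 2)) volume
  simp only [hn.neg_pow, neg_sq, neg_mul, integral_neg] at h
  linarith

theorem integral_coord_pow_mul_exp_neg_norm_sq (n : ℕ) :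
    ∫ x : EuclideanSpace ℝ (Fin 3), x 2 ^ n * Real.exp (-‖x‖ ^ 2) =
      Real.pi * ∫ r : ℝ, r ^ n * Real.exp (-r ^ 2) := by
  have h1 := (EuclideanSpace.volume_preserving_symm_measurableEquiv_toLp (Fin 3)).integral_comp'
    (f := (MeasurableEquiv.toLp 2 (Fin 3 → ℝ)).symm)
    (fun y : Fin 3 → ℝ => ∏ i, y i ^ (if i = 2 then n else 0) * Real.exp (-(y i) ^ 2))
  have h2 := integral_fintype_prod_volume_eq_prod
    (fun (i : Fin 3) (r : ℝ) => r ^ (if i = 2 then n else 0) * Real.exp (-r ^ 2))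
  rw [h2] at h1
  have hpi : ∫ r : ℝ, Real.exp (-r ^ 2) = √Real.pi := by
    simpa using integral_gaussian 1
  have h3 : (∏ i : Fin 3, ∫ r : ℝ, r ^ (if i = 2 then n else 0) * Real.exp (-r ^ 2)) =
      Real.pi * ∫ r : ℝ, r ^ n * Real.exp (-r ^ 2) := by
    simp [Fin.prod_univ_three, hpi, Real.mul_self_sqrt Real.pi_pos.le]
  rw [← h3, ← h1]
  refine integral_congr_ae (.of_forall fun x => ?_)
  simp [Fin.prod_univ_three, EuclideanSpace.norm_sq_eq, Fin.sum_univ_three, Real.exp_add]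
  ring

/-- The integral of `x₂^n exp(-|x|²)` over space is computed in polar coordinates and as a product
of line integrals. The Gamma factors cancel by the functional equation, leaving the moments of a
uniform distribution. -/
theorem integral_coord_pow (n : ℕ) :
    ∫ x : S2, x.1 2 ^ n ∂areaMeasure = 2 * Real.pi * ∫ t in (-1 : ℝ)..1, t ^ n := by
  have h := integral_polar (f := fun x : S2 => x.1 2 ^ n)
    (h := fun r => r ^ n * Real.exp (-r ^ 2)) (F := fun x => x 2 ^ n * Real.exp (-‖x‖ ^ 2))
    (fun x r hr => by
      have hx : ‖x.1‖ = 1 := by simp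
      simp only [PiLp.smul_apply, smul_eq_mul, norm_smul, hx, Real.norm_eq_abs, mul_one, sq_abs]
      ring)
  have h2 : ∫ r in Ioi (0 : ℝ), r ^ 2 * (r ^ n * Real.exp (-r ^ 2)) =
      1 / 2 * ((((n : ℝ) + 1) / 2) * Real.Gamma (((n : ℝ) + 1) / 2)) := by
    have := integral_pow_mul_exp_neg_sq_Ioi (n + 2)
    rw [← Real.Gamma_add_one (by positivity)]
    convert this using 2
    · funext r
      ring
    · push_cast
      ring_nf
  rw [integral_coord_pow_mul_exp_neg_norm_sq, h2] at h
  have hG : 0 < Real.Gamma (((n : ℝ) + 1) / 2) := Real.Gamma_pos_of_pos (by positivity)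
  have hn : (0 : ℝ) < (n : ℝ) + 1 := by positivity
  rw [integral_pow]
  rcases Nat.even_or_odd n with he | ho
  · rw [integral_pow_mul_exp_neg_sq_of_even he] at h
    rw [(he.add_one).neg_one_pow]
    field_simp at h ⊢
    simp only [one_pow]
    linear_combination -h
  · rw [integral_pow_mul_exp_neg_sq_of_odd ho] at h
    rw [(ho.add_one).neg_one_pow]
    have : (∫ x : S2, x.1 2 ^ n ∂areaMeasure) = 0 := by
      have h0 := mul_eq_zero.1 (h.symm.trans (mul_zero _))
      exact h0.resolve_right (by positivity)
    rw [this]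
    simp

/-- Archimedes' theorem: a coordinate of a uniformly distributed point of the sphere is uniformly
distributed. -/
theorem map_coord_areaMeasure :
    areaMeasure.map (fun x : S2 => x.1 2) =
      ENNReal.ofReal (2 * Real.pi) • (volume : Measure ℝ).restrict (Icc (-1) 1) := by
  have hm : Measurable fun x : S2 => x.1 2 := by fun_prop
  have hfin2 : IsFiniteMeasure
      (ENNReal.ofReal (2 * Real.pi) • (volume : Measure ℝ).restrict (Icc (-1) 1)) :=
    Measure.smul_finite _ ENNReal.ofReal_ne_top
  refine ext_of_forall_integral_eq_of_IsFiniteMeasure fun f => ?_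
  have hcoord : ∀ x : S2, x.1 2 ∈ Icc (-1 : ℝ) 1 := fun x => by
    have h1 : ‖x.1‖ = 1 := by simp
    have := PiLp.norm_apply_le x.1 2
    rw [h1, Real.norm_eq_abs] at this
    exact abs_le.1 this
  have hL : ∀ h : ℝ → ℝ, Continuous h → ∫ t, h t ∂areaMeasure.map (fun x : S2 => x.1 2) =
      ∫ x : S2, h (x.1 2) ∂areaMeasure := fun h hh =>
    integral_map hm.aemeasurable hh.aestronglyMeasurable
  have hR : ∀ h : ℝ → ℝ, ∫ t, h t ∂(ENNReal.ofReal (2 * Real.pi) •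
      (volume : Measure ℝ).restrict (Icc (-1) 1)) = 2 * Real.pi * ∫ t in (-1 : ℝ)..1, h t := by
    intro h
    rw [integral_smul_measure, intervalIntegral.integral_of_le (by norm_num),
      integral_Icc_eq_integral_Ioc, ENNReal.toReal_ofReal (by positivity), smul_eq_mul]
  rw [hL f f.continuous, hR]
  have hint : ∀ h : ℝ → ℝ, Continuous h → Integrable (fun x : S2 => h (x.1 2)) areaMeasure := by
    intro h hh
    refine Continuous.integrable_of_hasCompactSupport (by fun_prop) ?_
    exact HasCompactSupport.of_compactSpace _
  -- Equality of moments gives equality on polynomials; Weierstrass approximation on `[-1, 1]`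
  -- extends it to bounded continuous functions, which determine a finite measure.
  have hpoly : ∀ p : Polynomial ℝ, ∫ x : S2, p.eval (x.1 2) ∂areaMeasure =
      2 * Real.pi * ∫ t in (-1 : ℝ)..1, p.eval t := by
    intro p
    induction p using Polynomial.induction_on' with
    | add p q hp hq =>
      simp only [Polynomial.eval_add]
      rw [integral_add (hint _ p.continuous) (hint _ q.continuous), hp, hq,
        intervalIntegral.integral_add (p.continuous.intervalIntegrable _ _)
          (q.continuous.intervalIntegrable _ _)]
      ring
    | monomial n a =>
      simp only [Polynomial.eval_monomial]
      rw [integral_const_mul, intervalIntegral.integral_const_mul, integral_coord_pow]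
      ring
  refine eq_of_forall_dist_le fun ε hε => ?_
  have hV : 0 ≤ areaMeasure.real univ := measureReal_nonneg
  -- The sum of the masses of the two measures, so that approximation within `ε / V` costs `ε` in
  -- total.
  set V := areaMeasure.real univ + 4 * Real.pi with hVdef
  have hVpos : 0 < V := by positivity
  obtain ⟨p, hp⟩ := exists_polynomial_near_of_continuousOn (-1) 1 f f.continuous.continuousOn
    (ε / V) (by positivity)
  have h1 : ‖∫ x : S2, (f (x.1 2) - p.eval (x.1 2)) ∂areaMeasure‖ ≤
      ε / V * areaMeasure.real univ := by
    refine norm_integral_le_of_norm_le_const (.of_forall fun x => ?_)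
    rw [Real.norm_eq_abs, abs_sub_comm]
    exact (hp _ (hcoord x)).le
  have h2 : ‖∫ t in (-1 : ℝ)..1, (f t - p.eval t)‖ ≤ ε / V * |1 - (-1)| := by
    refine intervalIntegral.norm_integral_le_of_norm_le_const fun t ht => ?_
    rw [uIoc_of_le (by norm_num)] at ht
    rw [Real.norm_eq_abs, abs_sub_comm]
    exact (hp _ ⟨ht.1.le, ht.2⟩).le
  rw [integral_sub (hint f f.continuous) (hint _ p.continuous), hpoly, Real.norm_eq_abs] at h1
  rw [intervalIntegral.integral_sub (f.continuous.intervalIntegrable _ _)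
    (p.continuous.intervalIntegrable _ _), Real.norm_eq_abs] at h2
  rw [Real.dist_eq]
  have h3 : |1 - (-1 : ℝ)| = 2 := by norm_num
  rw [h3] at h2
  set I1 := ∫ x : S2, f (x.1 2) ∂areaMeasure
  set I2 := ∫ t in (-1 : ℝ)..1, f t
  set J := ∫ t in (-1 : ℝ)..1, p.eval t
  calc |I1 - 2 * Real.pi * I2| = |(I1 - 2 * Real.pi * J) - 2 * Real.pi * (I2 - J)| := by ring_nf
    _ ≤ |I1 - 2 * Real.pi * J| + |2 * Real.pi * (I2 - J)| := abs_sub _ _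
    _ ≤ ε / V * areaMeasure.real univ + 2 * Real.pi * (ε / V * 2) := by
      rw [abs_mul, abs_of_pos (by positivity : 0 < 2 * Real.pi)]
      gcongr
    _ = ε / V * V := by rw [hVdef]; ring
    _ = ε := div_mul_cancel₀ _ hVpos.ne'

end SphericalField

/-! ### Shifted Legendre polynomials -/

/-- The shifted Legendre polynomials, with real coefficients. -/
noncomputable def realShiftedLegendre (n : ℕ) : Polynomial ℝ :=
  (Polynomial.shiftedLegendre n).map (Int.castRingHom ℝ)

namespace realShiftedLegendre

open Polynomial

theorem factorial_mul (n : ℕ) : (n.factorial : ℝ[X]) * realShiftedLegendre n =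
    derivative^[n] (X ^ n * (1 - X) ^ n) := by
  have h := congrArg (Polynomial.map (Int.castRingHom ℝ)) (factorial_mul_shiftedLegendre_eq n)
  rw [Polynomial.map_mul, ← iterate_derivative_map] at h
  simpa [realShiftedLegendre] using h

theorem coeff_eq (n k : ℕ) :
    (realShiftedLegendre n).coeff k = (-1) ^ k * n.choose k * (n + k).choose n := by
  simp [realShiftedLegendre, coeff_map, coeff_shiftedLegendre]

theorem natDegree_le (n : ℕ) : (realShiftedLegendre n).natDegree ≤ n := by
  unfold realShiftedLegendre
  exact (natDegree_map_le).trans (natDegree_shiftedLegendre n).le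

theorem eval_zero (n : ℕ) : (realShiftedLegendre n).eval 0 = 1 := by
  rw [← coeff_zero_eq_eval_zero, coeff_eq]
  simp

theorem eval_one (n : ℕ) : (realShiftedLegendre n).eval 1 = (-1) ^ n := by
  have h := shiftedLegendre_eval_symm n (1 : ℝ)
  have h2 : ∀ x : ℝ, aeval x (shiftedLegendre n) = (realShiftedLegendre n).eval x := by
    intro x
    rw [realShiftedLegendre, eval_map, aeval_def]
    rfl
  rw [h2, h2, sub_self, eval_zero, mul_one] at h
  exact h

/-- Leibniz' rule applied to Rodrigues' formula. This is the form that the diagonal terms of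
Laplace's average will produce. -/
theorem eval_eq_sum (n : ℕ) (w : ℝ) : (realShiftedLegendre n).eval w =
    ∑ k ∈ Finset.range (n + 1), (n.choose k : ℝ) ^ 2 * ((1 - w) ^ (n - k) * (-w) ^ k) := by
  have hf : (n.factorial : ℝ) ≠ 0 := by exact_mod_cast n.factorial_ne_zero
  apply mul_left_cancel₀ hf
  have h := congrArg (Polynomial.eval w) (factorial_mul n)
  rw [eval_mul, eval_natCast] at h
  rw [h, iterate_derivative_mul, eval_finsetSum, Finset.mul_sum]
  refine Finset.sum_congr rfl fun k hk => ?_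
  have hkn : k ≤ n := Nat.lt_succ_iff.1 (Finset.mem_range.1 hk)
  have h1 : (1 - X : ℝ[X]) ^ n = (X ^ n : ℝ[X]).comp (1 - X) := by simp
  have e2 : n - (n - k) = k := by omega
  rw [h1, iterate_derivative_comp_one_sub_X, iterate_derivative_X_pow_eq_natCast_mul,
    iterate_derivative_X_pow_eq_natCast_mul]
  have hd1 : ((n - k).factorial : ℝ) * n.descFactorial k = n.factorial := by
    exact_mod_cast Nat.factorial_mul_descFactorial hkn
  have hd2 : (k.factorial : ℝ) * n.descFactorial (n - k) = n.factorial := by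
    have := Nat.factorial_mul_descFactorial (Nat.sub_le n k)
    rw [e2] at this
    exact_mod_cast this
  have hc : (n.choose k : ℝ) * k.factorial * (n - k).factorial = n.factorial := by
    exact_mod_cast Nat.choose_mul_factorial_mul_factorial hkn
  have hk0 : (k.factorial : ℝ) ≠ 0 := by exact_mod_cast k.factorial_ne_zero
  have hnk0 : ((n - k).factorial : ℝ) ≠ 0 := by exact_mod_cast (n - k).factorial_ne_zero
  have hc1 : (n.descFactorial k : ℝ) * n.descFactorial (n - k) =
      n.factorial * n.choose k := by
    apply mul_left_cancel₀ (mul_ne_zero hk0 hnk0)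
    calc (k.factorial : ℝ) * (n - k).factorial * (n.descFactorial k * n.descFactorial (n - k))
        = ((n - k).factorial * n.descFactorial k) * (k.factorial * n.descFactorial (n - k)) := by
          ring
      _ = n.factorial * (n.choose k * k.factorial * (n - k).factorial) := by
          rw [hd1, hd2, hc]
      _ = _ := by ring
  rw [e2]
  simp only [nsmul_eq_mul, eval_mul, eval_natCast, eval_pow, eval_X, eval_neg, Polynomial.eval_one, eval_comp,
    eval_sub]
  rw [neg_pow w]
  linear_combination (n.choose k * (-1) ^ k * (1 - w) ^ (n - k) * w ^ k) * hc1

/-- Integration by parts against a Rodrigues-type derivative. -/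
theorem integral_iterate_derivative_mul (n j : ℕ) (hj : j ≤ n) (q : ℝ[X]) :
    ∫ w in (0 : ℝ)..1, (derivative^[j] ((X : ℝ[X]) ^ n * (1 - X) ^ n)).eval w * q.eval w =
      (-1) ^ j * ∫ w in (0 : ℝ)..1, ((X : ℝ[X]) ^ n * (1 - X) ^ n).eval w *
        (derivative^[j] q).eval w := by
  induction j generalizing q with
  | zero => simp
  | succ j ih =>
    set g : ℝ[X] := (X : ℝ[X]) ^ n * (1 - X) ^ n with hg
    -- After `j < n` derivatives a positive power of `X` and of `1 - X` still divides, so the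
    -- boundary terms vanish.
    have hX : ((X : ℝ[X]) ^ (n - j)) ∣ derivative^[j] g :=
      pow_sub_dvd_iterate_derivative_of_pow_dvd j (Dvd.intro _ rfl)
    have hX1 : ((1 - X : ℝ[X]) ^ (n - j)) ∣ derivative^[j] g :=
      pow_sub_dvd_iterate_derivative_of_pow_dvd j (Dvd.intro_left _ rfl)
    have hnj : n - j ≠ 0 := by omega
    have h0 : (derivative^[j] g).eval 0 = 0 := by
      obtain ⟨r, hr⟩ := hX
      rw [hr]
      simp [hnj]
    have h1 : (derivative^[j] g).eval 1 = 0 := by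
      obtain ⟨r, hr⟩ := hX1
      rw [hr]
      simp [hnj]
    have hparts := intervalIntegral.integral_deriv_mul_eq_sub
      (u := fun w => (derivative^[j] g).eval w) (v := fun w => q.eval w)
      (u' := fun w => (derivative (derivative^[j] g)).eval w)
      (v' := fun w => (derivative q).eval w) (a := 0) (b := 1)
      (fun w _ => (derivative^[j] g).hasDerivAt w) (fun w _ => q.hasDerivAt w)
      ((Polynomial.continuous _).intervalIntegrable _ _)
      ((Polynomial.continuous _).intervalIntegrable _ _)
    simp only [h0, h1, zero_mul, sub_zero] at hparts
    have hint : ∀ p q : ℝ[X], IntervalIntegrable (fun w => p.eval w * q.eval w) volume 0 1 :=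
      fun p q => (p.continuous.mul q.continuous).intervalIntegrable _ _
    rw [intervalIntegral.integral_add (hint _ _) (hint _ _), ih (by omega)] at hparts
    rw [Function.iterate_succ_apply', Function.iterate_succ_apply, eq_neg_of_add_eq_zero_left hparts]
    ring

/-- By Rodrigues' formula, `n` integrations by parts move all derivatives to `q`, which they
annihilate. -/
theorem integral_mul_eq_zero {n : ℕ} {q : ℝ[X]} (hq : q.natDegree < n) :
    ∫ w in (0 : ℝ)..1, (realShiftedLegendre n).eval w * q.eval w = 0 := by
  have hf : (n.factorial : ℝ) ≠ 0 := by exact_mod_cast n.factorial_ne_zero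
  apply mul_left_cancel₀ hf
  rw [mul_zero, ← intervalIntegral.integral_const_mul]
  have h := integral_iterate_derivative_mul n n le_rfl q
  rw [← factorial_mul, iterate_derivative_eq_zero hq] at h
  simpa [mul_assoc] using h

theorem integral_mul_of_ne {n m : ℕ} (hnm : n ≠ m) :
    ∫ w in (0 : ℝ)..1, (realShiftedLegendre n).eval w * (realShiftedLegendre m).eval w = 0 := by
  rcases hnm.lt_or_gt with h | h
  · simp_rw [mul_comm ((realShiftedLegendre n).eval _)]
    exact integral_mul_eq_zero ((natDegree_le n).trans_lt h)
  · exact integral_mul_eq_zero ((natDegree_le m).trans_lt h)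

/-- Integrate `(w p²)' = (2n+1) p² + 2p (w p' - n p)`. The leading terms of `w p' - n p` cancel, so
it is orthogonal to `p`; the boundary value is `p(1)² = 1`. -/
theorem integral_sq (n : ℕ) :
    ∫ w in (0 : ℝ)..1, (realShiftedLegendre n).eval w ^ 2 = 1 / (2 * n + 1) := by
  set p := realShiftedLegendre n with hp
  rcases Nat.eq_zero_or_pos n with rfl | hn
  · have : ∀ w, p.eval w = 1 := fun w => by simp [hp, eval_eq_sum]
    simp [this]
  have hint : ∀ q : ℝ[X], IntervalIntegrable (fun w => q.eval w) volume 0 1 := fun q =>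
    q.continuous.intervalIntegrable _ _
  have hdeg : (X * derivative p - C (n : ℝ) * p).natDegree < n := by
    have hle : (X * derivative p - C (n : ℝ) * p).natDegree ≤ n - 1 := by
      rw [natDegree_le_iff_coeff_eq_zero]
      intro k hk
      obtain ⟨k, rfl⟩ : ∃ j, k = j + 1 := ⟨k - 1, by omega⟩
      rw [coeff_sub, coeff_X_mul, coeff_C_mul, coeff_derivative]
      rcases eq_or_ne (k + 1) n with h | h
      · rw [← h]
        push_cast
        ring
      · rw [coeff_eq_zero_of_natDegree_lt (p := p) (n := k + 1)
          ((natDegree_le n).trans_lt (by omega))]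
        ring
    omega
  have horth := integral_mul_eq_zero hdeg
  rw [← hp] at horth
  have hder : ∀ w : ℝ, HasDerivAt (fun w => (X * p ^ 2).eval w)
      ((derivative (X * p ^ 2)).eval w) w := fun w => Polynomial.hasDerivAt _ w
  have hftc := intervalIntegral.integral_eq_sub_of_hasDerivAt (a := 0) (b := 1)
    (fun w _ => hder w) (hint _)
  have hone : p.eval 1 ^ 2 = 1 := by rw [hp, eval_one, ← pow_mul, mul_comm, pow_mul]; simp
  have hsplit : ∀ w, (derivative (X * p ^ 2)).eval w = (2 * n + 1) * p.eval w ^ 2 +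
      2 * (p.eval w * (X * derivative p - C (n : ℝ) * p).eval w) := by
    intro w
    simp [derivative_pow]
    ring
  simp_rw [hsplit] at hftc
  rw [intervalIntegral.integral_add, intervalIntegral.integral_const_mul,
    intervalIntegral.integral_const_mul, horth] at hftc
  · simp only [eval_mul, eval_X, eval_pow, hone] at hftc
    rw [eq_div_iff (by positivity)]
    linarith
  · exact ((p.continuous.pow 2).const_mul _).intervalIntegrable _ _
  · exact ((p.continuous.mul (Polynomial.continuous _)).const_mul _).intervalIntegrable _ _

/-- With `y = n(n+1)w ≤ 1` the polynomial is `1 - y` plus terms dominated by a geometric series of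
ratio `1/4`. The remainder is at most `y/3`, so the deficit is at least `2y/3`. -/
theorem le_one_sub_eval {n : ℕ} {w : ℝ} (hw : 0 ≤ w) (hn : (n : ℝ) * (n + 1) * w ≤ 1) :
    (n : ℝ) * (n + 1) * w / 2 ≤ 1 - (realShiftedLegendre n).eval w := by
  rcases Nat.eq_zero_or_pos n with rfl | hnpos
  · simp [eval_eq_sum]
  set y := (n : ℝ) * (n + 1) * w with hy
  have hy0 : 0 ≤ y := by positivity
  let b : ℕ → ℝ := fun k => (n.choose k : ℝ) * (n + k).choose n * w ^ k
  have hb0 : ∀ k, 0 ≤ b k := fun k => by positivity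
  have hrec : ∀ k : ℕ, ((k : ℝ) + 1) ^ 2 * b (k + 1) ≤ y * b k := by
    intro k
    rcases lt_or_ge n k with hk | hk
    · simp [b, Nat.choose_eq_zero_of_lt hk, Nat.choose_eq_zero_of_lt (hk.trans (Nat.lt_succ_self k))]
    have h1 : (n.choose (k + 1) : ℝ) * (k + 1) = n.choose k * (n - k) := by
      have := Nat.choose_succ_right_eq n k
      rw [← Nat.cast_sub hk]
      exact_mod_cast this
    have h2 : ((n + (k + 1)).choose n : ℝ) * (k + 1) = (n + k).choose n * (n + k + 1) := by
      have := Nat.choose_succ_right_eq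
      have h3 := Nat.choose_mul_succ_eq (n + k) n
      have h4 : n + k + 1 - n = k + 1 := by omega
      rw [h4] at h3
      rw [← add_assoc]
      exact_mod_cast h3.symm
    have hk' : (k : ℝ) ≤ n := by exact_mod_cast hk
    calc ((k : ℝ) + 1) ^ 2 * b (k + 1) = ((n.choose (k + 1) : ℝ) * (k + 1)) *
          (((n + (k + 1)).choose n : ℝ) * (k + 1)) * w ^ (k + 1) := by simp only [b]; ring
      _ = ((n - k) * (n + k + 1) * w) * b k := by rw [h1, h2]; simp only [b]; ring
      _ ≤ y * b k := by
        refine mul_le_mul_of_nonneg_right ?_ (hb0 k)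
        rw [hy]
        refine mul_le_mul_of_nonneg_right ?_ hw
        nlinarith [k.cast_nonneg (α := ℝ)]
  have hb1 : b 1 = y := by
    simp only [b, hy]
    rw [Nat.choose_one_right, Nat.choose_succ_self_right]
    push_cast
    ring
  -- The divisor in the recursion from `b (k + 1)` to `b (k + 2)` is `(k + 2)² ≥ 4`.
  have hb : ∀ k, b (k + 1) ≤ y * (1 / 4) ^ k := by
    intro k
    induction k with
    | zero => simp [hb1]
    | succ k ih =>
      have h1 := hrec (k + 1)
      have h2 : y * b (k + 1) ≤ 1 * b (k + 1) := mul_le_mul_of_nonneg_right hn (hb0 _)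
      have h3 : (4 : ℝ) * b (k + 1 + 1) ≤ (((k + 1 : ℕ) : ℝ) + 1) ^ 2 * b (k + 1 + 1) := by
        refine mul_le_mul_of_nonneg_right ?_ (hb0 _)
        push_cast
        nlinarith [k.cast_nonneg (α := ℝ)]
      rw [pow_succ]
      linarith
  have hsum : ∀ N, ∑ k ∈ Finset.range (N + 2), (-1) ^ k * b k ≤
      1 - y + y / 3 * (1 - (1 / 4) ^ N) := by
    intro N
    induction N with
    | zero =>
      rw [Finset.sum_range_succ, Finset.sum_range_one, hb1]
      simp [b]
    | succ N ih =>
      rw [Finset.sum_range_succ]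
      have h1 : (-1) ^ (N + 2) * b (N + 2) ≤ b (N + 2) := by
        rcases neg_one_pow_eq_or ℝ (N + 2) with h | h <;> rw [h] <;> linarith [hb0 (N + 2)]
      have h2 := hb (N + 1)
      rw [pow_succ (1 / 4 : ℝ)] at h2 ⊢
      have h3 : N + 1 + 1 = N + 2 := rfl
      rw [h3] at h2
      linarith
  -- For `n ≥ 1` the range `n - 1 + 2` is all degrees up to `n`, in the form required by `hsum`.
  have heval : (realShiftedLegendre n).eval w = ∑ k ∈ Finset.range (n - 1 + 2), (-1) ^ k * b k := by
    rw [eval_eq_sum_range' (n := n - 1 + 2) ((natDegree_le n).trans_lt (by omega))]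
    refine Finset.sum_congr rfl fun k _ => ?_
    rw [coeff_eq]
    simp only [b]
    ring
  have := hsum (n - 1)
  rw [← heval] at this
  have h4 : (0 : ℝ) ≤ (1 / 4) ^ (n - 1) := by positivity
  nlinarith

end realShiftedLegendre

/-! ### Laplace's formula as an average over roots of unity -/

section RootsOfUnity

open Finset

/-- For distinct exponents the sum is geometric with ratio `ζ^(a-b) ≠ 1`. Exponents below `N`
suffice, which is why averages over more than `n` roots integrate the degree-`n` expressions
exactly. -/
theorem IsPrimitiveRoot.sum_pow_mul_inv_pow {ζ : ℂ} {N : ℕ} (hζ : IsPrimitiveRoot ζ N) {a b : ℕ}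
    (ha : a < N) (hb : b < N) :
    ∑ j ∈ range N, (ζ ^ j) ^ a * ((ζ ^ j)⁻¹) ^ b = if a = b then (N : ℂ) else 0 := by
  have hζ0 : ζ ≠ 0 := hζ.ne_zero (by omega)
  have h : ∀ j, (ζ ^ j) ^ a * ((ζ ^ j)⁻¹) ^ b = (ζ ^ a * (ζ⁻¹) ^ b) ^ j := by
    intro j
    rw [mul_pow, ← pow_mul, ← pow_mul, ← pow_mul, inv_pow, inv_pow, ← pow_mul, mul_comm j a,
      mul_comm j b]
  simp_rw [h]
  split_ifs with hab
  · subst hab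
    simp [hζ0]
  · have hne : ζ ^ a * (ζ⁻¹) ^ b ≠ 1 := by
      intro h1
      rw [inv_pow, mul_inv_eq_one₀ (pow_ne_zero _ hζ0)] at h1
      exact hab (hζ.pow_inj ha hb h1)
    rw [geom_sum_eq hne, mul_pow, ← pow_mul, ← pow_mul, mul_comm a, mul_comm b, pow_mul, pow_mul,
      inv_pow, hζ.pow_eq_one]
    simp

/-- The average over the roots of unity of a power of `A z + B z⁻¹` depends on `A B` only. -/
theorem IsPrimitiveRoot.sum_pow_congr {ζ : ℂ} {N : ℕ} (hζ : IsPrimitiveRoot ζ N) {m : ℕ}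
    (hm : m < N) {A B A' B' : ℂ} (h : A * B = A' * B') :
    ∑ j ∈ range N, (A * ζ ^ j + B * (ζ ^ j)⁻¹) ^ m =
      ∑ j ∈ range N, (A' * ζ ^ j + B' * (ζ ^ j)⁻¹) ^ m := by
  have key : ∀ A B : ℂ, ∑ j ∈ range N, (A * ζ ^ j + B * (ζ ^ j)⁻¹) ^ m =
      ∑ k ∈ range (m + 1), if k = m - k then m.choose k * (A * B) ^ k * N else 0 := by
    intro A B
    simp_rw [add_pow]
    rw [sum_comm]
    refine sum_congr rfl fun k hk => ?_
    have hk' : k ≤ m := Nat.lt_succ_iff.1 (mem_range.1 hk)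
    have h1 : ∀ j, (A * ζ ^ j) ^ k * (B * (ζ ^ j)⁻¹) ^ (m - k) * (m.choose k : ℂ) =
        (m.choose k * (A ^ k * B ^ (m - k))) * ((ζ ^ j) ^ k * ((ζ ^ j)⁻¹) ^ (m - k)) := by
      intro j
      rw [mul_pow, mul_pow]
      ring
    simp_rw [h1]
    rw [← mul_sum, hζ.sum_pow_mul_inv_pow (by omega) (by omega)]
    split_ifs with hkm
    · rw [← hkm, mul_pow]
    · rw [mul_zero]
  rw [key, key, h]

theorem IsPrimitiveRoot.sum_add_pow_congr {ζ : ℂ} {N : ℕ} (hζ : IsPrimitiveRoot ζ N) {n : ℕ}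
    (hn : n < N) (c : ℂ) {A B A' B' : ℂ} (h : A * B = A' * B') :
    ∑ j ∈ range N, (c + (A * ζ ^ j + B * (ζ ^ j)⁻¹)) ^ n =
      ∑ j ∈ range N, (c + (A' * ζ ^ j + B' * (ζ ^ j)⁻¹)) ^ n := by
  have key : ∀ A B : ℂ, ∑ j ∈ range N, (c + (A * ζ ^ j + B * (ζ ^ j)⁻¹)) ^ n =
      ∑ k ∈ range (n + 1), c ^ k * n.choose k *
        ∑ j ∈ range N, (A * ζ ^ j + B * (ζ ^ j)⁻¹) ^ (n - k) := by
    intro A B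
    simp_rw [add_pow c]
    rw [sum_comm]
    refine sum_congr rfl fun k _ => ?_
    rw [mul_sum]
    exact sum_congr rfl fun j _ => by ring
  rw [key, key]
  refine sum_congr rfl fun k _ => ?_
  rw [hζ.sum_pow_congr (by omega) h]

/-- Laplace's formula for the Legendre polynomials, with the integral over the circle replaced by
the average over the roots of unity. -/
theorem IsPrimitiveRoot.sum_add_pow_eq_legendre {ζ : ℂ} {N : ℕ} (hζ : IsPrimitiveRoot ζ N) {n : ℕ}
    (hn : n < N) (v A B : ℂ) (w : ℝ) (h : A * B = -v ^ 2 * w * (1 - w)) :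
    ∑ j ∈ range N, (v * (1 - 2 * w) + (A * ζ ^ j + B * (ζ ^ j)⁻¹)) ^ n =
      N * (v ^ n * (((realShiftedLegendre n).eval w : ℝ) : ℂ)) := by
  have hζ0 : ζ ≠ 0 := hζ.ne_zero (by omega)
  -- Only the product `A B` matters; this choice makes the base factor as `v (1 - w - w z⁻¹)(z +
  -- 1)`, and orthogonality then keeps the diagonal of the double binomial expansion.
  rw [hζ.sum_add_pow_congr hn _ (A' := v * (1 - w)) (B' := -(v * w)) (by rw [h]; ring)]
  have h1 : ∀ j, (v * (1 - 2 * w) + (v * (1 - w) * ζ ^ j + -(v * w) * (ζ ^ j)⁻¹)) ^ n =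
      v ^ n * ∑ k ∈ range (n + 1), ∑ l ∈ range (n + 1),
        (n.choose k * n.choose l * (1 - w) ^ (n - k) * (-w) ^ k : ℂ) *
          ((ζ ^ j) ^ l * ((ζ ^ j)⁻¹) ^ k) := by
    intro j
    have hz : (ζ ^ j) * (ζ ^ j)⁻¹ = 1 := mul_inv_cancel₀ (pow_ne_zero _ hζ0)
    have h2 : v * (1 - 2 * w) + (v * (1 - w) * ζ ^ j + -(v * w) * (ζ ^ j)⁻¹) =
        v * ((-w * (ζ ^ j)⁻¹ + (1 - w)) * (ζ ^ j + 1)) := by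
      linear_combination (v * w) * hz
    rw [h2, mul_pow, mul_pow, add_pow, add_pow, sum_mul_sum]
    congr 1
    refine sum_congr rfl fun k _ => sum_congr rfl fun l _ => ?_
    rw [mul_pow, one_pow]
    ring
  simp_rw [h1]
  rw [← mul_sum, sum_comm]
  have h3 : ∀ k ∈ range (n + 1), ∑ j ∈ range N, ∑ l ∈ range (n + 1),
      (n.choose k * n.choose l * (1 - w) ^ (n - k) * (-w) ^ k : ℂ) *
        ((ζ ^ j) ^ l * ((ζ ^ j)⁻¹) ^ k) =
      N * ((n.choose k : ℂ) ^ 2 * ((1 - w) ^ (n - k) * (-w) ^ k)) := by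
    intro k hk
    have hk' := mem_range.1 hk
    rw [sum_comm]
    have h4 : ∀ l ∈ range (n + 1), ∑ j ∈ range N,
        (n.choose k * n.choose l * (1 - w) ^ (n - k) * (-w) ^ k : ℂ) *
          ((ζ ^ j) ^ l * ((ζ ^ j)⁻¹) ^ k) = if l = k then
          N * ((n.choose k : ℂ) ^ 2 * ((1 - w) ^ (n - k) * (-w) ^ k)) else 0 := by
      intro l hl
      have hl' := mem_range.1 hl
      rw [← mul_sum, hζ.sum_pow_mul_inv_pow (by omega) (by omega)]
      split_ifs with hlk
      · subst hlk
        ring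
      · rw [mul_zero]
    rw [sum_congr rfl h4, sum_ite_eq' _ _ _, if_pos hk]
  rw [sum_congr rfl h3, ← mul_sum, realShiftedLegendre.eval_eq_sum]
  push_cast
  ring

end RootsOfUnity

/-! ### Zonal harmonics and the Funk-Hecke formula -/

namespace SphericalField

open scoped InnerProductSpace

/-- The Legendre polynomial of degree `n`, as a function. -/
noncomputable def legendre (n : ℕ) (t : ℝ) : ℝ := (realShiftedLegendre n).eval ((1 - t) / 2)

theorem continuous_legendre (n : ℕ) : Continuous (legendre n) := by
  unfold legendre
  fun_prop

theorem legendre_one (n : ℕ) : legendre n 1 = 1 := by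
  simp [legendre, realShiftedLegendre.eval_zero]

/-- The value at `z` of the linear form with coefficient vector `a + i b`. -/
noncomputable def complexForm (a b z : EuclideanSpace ℝ (Fin 3)) : ℂ :=
  (⟪a, z⟫_ℝ : ℂ) + Complex.I * (⟪b, z⟫_ℝ : ℂ)

theorem continuous_complexForm (a b : EuclideanSpace ℝ (Fin 3)) : Continuous (complexForm a b) := by
  unfold complexForm
  fun_prop

section Harmonic

open MvPolynomial

theorem IsSphericalHarmonic.sum {ι : Type*} {s : Finset ι} {n : ℕ} {Y : ι → S2 → ℂ}
    (h : ∀ i ∈ s, IsSphericalHarmonic n (Y i)) :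
    IsSphericalHarmonic n fun x => ∑ i ∈ s, Y i x := by
  choose! p hp hl he using h
  refine ⟨∑ i ∈ s, p i, IsHomogeneous.sum _ _ _ hp, ?_, fun x => ?_⟩
  · have : laplacian (∑ i ∈ s, p i) = ∑ i ∈ s, laplacian (p i) := by
      simp only [laplacian, map_sum]
      rw [Finset.sum_comm]
    rw [this]
    exact Finset.sum_eq_zero hl
  · rw [map_sum]
    exact Finset.sum_congr rfl fun i hi => he i hi x

theorem IsSphericalHarmonic.const_mul {n : ℕ} {Y : S2 → ℂ} (h : IsSphericalHarmonic n Y) (c : ℂ) :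
    IsSphericalHarmonic n fun x => c * Y x := by
  obtain ⟨p, hp, hl, he⟩ := h
  refine ⟨C c * p, by simpa using (isHomogeneous_C (Fin 3) c).mul hp, ?_, fun x => ?_⟩
  · have : laplacian (C c * p) = C c * laplacian p := by
      simp [laplacian, Finset.mul_sum, Derivation.leibniz]
    rw [this, hl, mul_zero]
  · simp [he]

theorem sum_sq_add_I_mul_eq_zero {a b : EuclideanSpace ℝ (Fin 3)} (hab : ‖a‖ = ‖b‖)
    (h0 : ⟪a, b⟫_ℝ = 0) : ∑ i, ((a i : ℂ) + Complex.I * (b i : ℂ)) ^ 2 = 0 := by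
  have h1 : ∑ i, a i ^ 2 = ∑ i, b i ^ 2 := by
    rw [← EuclideanSpace.real_norm_sq_eq, ← EuclideanSpace.real_norm_sq_eq, hab]
  have h2 : ∑ i, a i * b i = 0 := by
    rw [← h0, PiLp.inner_apply]
    exact Finset.sum_congr rfl fun i _ => by simp [mul_comm]
  have h3 : ∀ i, ((a i : ℂ) + Complex.I * (b i : ℂ)) ^ 2 =
      ((a i ^ 2 : ℝ) : ℂ) - ((b i ^ 2 : ℝ) : ℂ) + 2 * Complex.I * ((a i * b i : ℝ) : ℂ) := by
    intro i
    push_cast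
    linear_combination ((b i : ℂ) ^ 2) * Complex.I_sq
  simp_rw [h3]
  rw [Finset.sum_add_distrib, Finset.sum_sub_distrib, ← Finset.mul_sum, ← Complex.ofReal_sum,
    ← Complex.ofReal_sum, ← Complex.ofReal_sum, h1, h2]
  simp

/-- The Laplacian of the power of a linear form `u · x` has the factor `∑ uᵢ²`, which vanishes for
`u = a + i b` with `a ⟂ b` of equal length. -/
theorem isSphericalHarmonic_complexForm_pow (n : ℕ) {a b : EuclideanSpace ℝ (Fin 3)}
    (hab : ‖a‖ = ‖b‖) (h0 : ⟪a, b⟫_ℝ = 0) :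
    IsSphericalHarmonic n fun x => complexForm a b x.1 ^ n := by
  set u : Fin 3 → ℂ := fun i => (a i : ℂ) + Complex.I * (b i : ℂ) with hu
  set p : MvPolynomial (Fin 3) ℂ := ∑ i, C (u i) * X i with hp
  refine ⟨p ^ n, ?_, ?_, fun x => ?_⟩
  · have : p.IsHomogeneous 1 := IsHomogeneous.sum _ _ _ fun i _ => isHomogeneous_C_mul_X _ _
    simpa using this.pow n
  · have hd : ∀ i, pderiv i p = C (u i) := by
      intro i
      simp only [hp, map_sum, Derivation.leibniz, pderiv_C, pderiv_X, smul_eq_mul, mul_zero,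
        add_zero]
      rw [Finset.sum_eq_single i (fun j _ hj => by simp [hj.symm])
        (fun h => absurd (Finset.mem_univ _) h)]
      simp
    -- The truncated exponent `n - 1 - 1` is harmless: for `n ≤ 1` the numerical factor is zero.
    have hd2 : ∀ i, pderiv i (pderiv i (p ^ n)) =
        (n : MvPolynomial (Fin 3) ℂ) * ((n - 1 : ℕ) : MvPolynomial (Fin 3) ℂ) * p ^ (n - 1 - 1) *
          C (u i ^ 2) := by
      intro i
      rw [Derivation.leibniz_pow, hd, map_nsmul, smul_eq_mul, Derivation.leibniz, pderiv_C,
        Derivation.leibniz_pow, hd]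
      simp
      ring
    have hu0 : ∑ i, u i ^ 2 = 0 := sum_sq_add_I_mul_eq_zero hab h0
    rw [laplacian]
    simp_rw [hd2]
    rw [← Finset.mul_sum, ← map_sum, hu0, map_zero, mul_zero]
  · rw [map_pow, hp, map_sum]
    change complexForm a b x.1 ^ n = _
    congr 1
    rw [complexForm, PiLp.inner_apply, PiLp.inner_apply, Complex.ofReal_sum, Complex.ofReal_sum,
      Finset.mul_sum, ← Finset.sum_add_distrib]
    refine Finset.sum_congr rfl fun i _ => ?_
    simp [hu]
    ring

end Harmonic

/-- The north pole of the sphere. -/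
noncomputable def northPole : S2 := ⟨EuclideanSpace.single 2 1, by simp⟩

theorem inner_northPole (z : EuclideanSpace ℝ (Fin 3)) : ⟪northPole.1, z⟫_ℝ = z 2 := by
  simp [northPole, EuclideanSpace.inner_single_left]

/-- A reflection will do, since area and inner products are invariant under all of `O(3)`. -/
theorem exists_rotate_eq_northPole (x : S2) :
    ∃ g : EuclideanSpace ℝ (Fin 3) ≃ₗᵢ[ℝ] EuclideanSpace ℝ (Fin 3), g x.1 = northPole.1 :=
  ⟨(ℝ ∙ (x.1 - northPole.1))ᗮ.reflection, Submodule.reflection_sub (by simp)⟩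

/-- The rotation by the angle `φ` about the third axis. -/
noncomputable def axisRotation (φ : ℝ) :
    EuclideanSpace ℝ (Fin 3) ≃ₗᵢ[ℝ] EuclideanSpace ℝ (Fin 3) :=
  LinearIsometry.toLinearIsometryEquiv
    { toFun := fun z => !₂[Real.cos φ * z 0 - Real.sin φ * z 1,
        Real.sin φ * z 0 + Real.cos φ * z 1, z 2]
      map_add' := fun z z' => by
        ext i
        fin_cases i <;> simp <;> ring
      map_smul' := fun c z => by
        ext i
        fin_cases i <;> simp <;> ring
      norm_map' := fun z => by
        rw [← sq_eq_sq₀ (norm_nonneg _) (norm_nonneg _), EuclideanSpace.real_norm_sq_eq,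
          EuclideanSpace.real_norm_sq_eq]
        simp [Fin.sum_univ_three]
        linear_combination (z 0 ^ 2 + z 1 ^ 2) * Real.sin_sq_add_cos_sq φ } rfl

theorem axisRotation_apply (φ : ℝ) (z : EuclideanSpace ℝ (Fin 3)) :
    axisRotation φ z = !₂[Real.cos φ * z 0 - Real.sin φ * z 1,
        Real.sin φ * z 0 + Real.cos φ * z 1, z 2] := rfl

/-- A point of the unit circle with its cosine and sine expressed by `ζ` and `ζ⁻¹`. -/
theorem exp_two_pi_mul_I_div_pow (N j : ℕ) :
    Complex.exp (2 * Real.pi * Complex.I / N) ^ j =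
      Complex.cos ((2 * Real.pi * j / N : ℝ)) + Complex.sin ((2 * Real.pi * j / N : ℝ)) * Complex.I ∧
    (Complex.exp (2 * Real.pi * Complex.I / N) ^ j)⁻¹ =
      Complex.cos ((2 * Real.pi * j / N : ℝ)) -
        Complex.sin ((2 * Real.pi * j / N : ℝ)) * Complex.I := by
  have h : Complex.exp (2 * Real.pi * Complex.I / N) ^ j =
      Complex.exp (((2 * Real.pi * j / N : ℝ) : ℂ) * Complex.I) := by
    rw [← Complex.exp_nat_mul]
    congr 1
    push_cast
    ring
  rw [h]
  refine ⟨Complex.exp_mul_I _, ?_⟩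
  rw [← Complex.exp_neg, ← neg_mul, Complex.exp_mul_I, Complex.cos_neg, Complex.sin_neg]
  ring

/-- Laplace's formula, with an average over equidistributed angles. -/
theorem sum_add_cos_add_sin_pow {n N : ℕ} (hn : n < N) (v p r : ℂ) (t : ℝ)
    (h : p ^ 2 + r ^ 2 = -v ^ 2 * (1 - (t : ℂ) ^ 2)) :
    ∑ j ∈ Finset.range N, (v * t + (p * Complex.cos ((2 * Real.pi * j / N : ℝ)) +
      r * Complex.sin ((2 * Real.pi * j / N : ℝ)))) ^ n = N * (v ^ n * (legendre n t : ℂ)) := by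
  have hζ := Complex.isPrimitiveRoot_exp N (by omega)
  rw [legendre, ← hζ.sum_add_pow_eq_legendre hn v ((p - Complex.I * r) / 2)
    ((p + Complex.I * r) / 2) ((1 - t) / 2) (by
      push_cast
      linear_combination h / 4 - r ^ 2 / 4 * Complex.I_sq)]
  refine Finset.sum_congr rfl fun j _ => ?_
  obtain ⟨h1, h2⟩ := exp_two_pi_mul_I_div_pow N j
  rw [h2, h1]
  congr 1
  push_cast
  linear_combination (r * Complex.sin (2 * Real.pi * j / N)) * Complex.I_sq

theorem sum_sq_eq_one (z : S2) : z.1 0 ^ 2 + z.1 1 ^ 2 + z.1 2 ^ 2 = 1 := by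
  have h : ‖z.1‖ = 1 := by simp
  have := EuclideanSpace.real_norm_sq_eq z.1
  rw [h, Fin.sum_univ_three] at this
  linarith

/-- Along the rotations the form is `u₂ z₂ + p cos φ + r sin φ`, and isotropy of `u` gives `p² + r²
= (u₀² + u₁²)(z₀² + z₁²) = -u₂²(1 - z₂²)`, the hypothesis of Laplace's formula. -/
theorem sum_complexForm_axisRotation_pow {n N : ℕ} (hn : n < N) {a b : EuclideanSpace ℝ (Fin 3)}
    (hab : ‖a‖ = ‖b‖) (h0 : ⟪a, b⟫_ℝ = 0) (z : S2) :
    ∑ j ∈ Finset.range N, complexForm a b (axisRotation (2 * Real.pi * j / N) z.1) ^ n =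
      N * (complexForm a b northPole.1 ^ n * (legendre n (z.1 2) : ℂ)) := by
  set u : Fin 3 → ℂ := fun i => (a i : ℂ) + Complex.I * (b i : ℂ) with hu
  have hu0 : u 0 ^ 2 + u 1 ^ 2 + u 2 ^ 2 = 0 := by
    have := sum_sq_add_I_mul_eq_zero hab h0
    rwa [Fin.sum_univ_three] at this
  have hform : ∀ y, complexForm a b y = u 0 * y 0 + u 1 * y 1 + u 2 * y 2 := by
    intro y
    rw [complexForm, PiLp.inner_apply, PiLp.inner_apply, Fin.sum_univ_three, Fin.sum_univ_three]
    simp [hu]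
    ring
  have hz : (z.1 0 : ℂ) ^ 2 + (z.1 1 : ℂ) ^ 2 + (z.1 2 : ℂ) ^ 2 = 1 := by
    have := congrArg Complex.ofReal (sum_sq_eq_one z)
    push_cast at this
    exact this
  have hN : complexForm a b northPole.1 = u 2 := by
    rw [hform]
    simp [northPole]
  rw [hN, ← sum_add_cos_add_sin_pow hn (u 2) (u 0 * z.1 0 + u 1 * z.1 1)
    (u 1 * z.1 0 - u 0 * z.1 1) (z.1 2) (by
      linear_combination ((z.1 0 : ℂ) ^ 2 + (z.1 1 : ℂ) ^ 2) * hu0 - u 2 ^ 2 * hz)]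
  refine Finset.sum_congr rfl fun j _ => ?_
  rw [hform, axisRotation_apply]
  congr 1
  simp
  ring

/-- The Funk-Hecke multiplier of the zonal kernel `q`. -/
noncomputable def zonalIntegral (q : ℝ → ℝ) (n : ℕ) : ℝ :=
  ∫ z : S2, q (z.1 2) * legendre n (z.1 2) ∂areaMeasure

theorem integrable_ofReal_mul {f : S2 → ℝ} (hf : Integrable f areaMeasure) {h : S2 → ℂ}
    (hh : Continuous h) : Integrable (fun z => (f z : ℂ) * h z) areaMeasure := by
  obtain ⟨C, hC⟩ := isCompact_univ.exists_bound_of_continuousOn hh.continuousOn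
  exact hf.ofReal.mul_bdd (c := C) hh.aestronglyMeasurable (.of_forall fun x => hC x (mem_univ x))

theorem continuous_complexForm_pow (a b : EuclideanSpace ℝ (Fin 3)) (n : ℕ) :
    Continuous fun z : S2 => complexForm a b z.1 ^ n :=
  ((continuous_complexForm a b).comp continuous_subtype_val).pow n

/-- Zonal functions with different poles are rotations of each other. -/
theorem exists_inner_eq_rotate (x : S2) :
    ∃ g : EuclideanSpace ℝ (Fin 3) ≃ₗᵢ[ℝ] EuclideanSpace ℝ (Fin 3),
      g x.1 = northPole.1 ∧ ∀ z : S2, ⟪x.1, z.1⟫_ℝ = (rotate g z).1 2 := by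
  obtain ⟨g, hg⟩ := exists_rotate_eq_northPole x
  refine ⟨g, hg, fun z => ?_⟩
  rw [← inner_northPole, ← hg]
  exact (g.inner_map_map _ _).symm

theorem integrable_inner {q : ℝ → ℝ} (hq : Integrable (fun z : S2 => q (z.1 2)) areaMeasure)
    (x : S2) : Integrable (fun z : S2 => q ⟪x.1, z.1⟫_ℝ) areaMeasure := by
  obtain ⟨g, -, hg⟩ := exists_inner_eq_rotate x
  simp_rw [hg]
  exact (measurePreserving_rotate g).integrable_comp_of_integrable hq

/-- Averaging the integrand over `n + 1` rotations about the axis leaves the integral and `q`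
unchanged, and turns the harmonic into its value at the pole times a Legendre polynomial. -/
theorem funkHecke_northPole {q : ℝ → ℝ} (hq : Integrable (fun z : S2 => q (z.1 2)) areaMeasure)
    (n : ℕ) {a b : EuclideanSpace ℝ (Fin 3)} (hab : ‖a‖ = ‖b‖) (h0 : ⟪a, b⟫_ℝ = 0) :
    ∫ z : S2, (q (z.1 2) : ℂ) * complexForm a b z.1 ^ n ∂areaMeasure =
      complexForm a b northPole.1 ^ n * (zonalIntegral q n : ℂ) := by
  have hN : ((n + 1 : ℕ) : ℂ) ≠ 0 := by exact_mod_cast n.succ_ne_zero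
  apply mul_left_cancel₀ hN
  set f : S2 → ℂ := fun z => (q (z.1 2) : ℂ) * complexForm a b z.1 ^ n with hf
  have hfint : Integrable f areaMeasure :=
    integrable_ofReal_mul hq (continuous_complexForm_pow a b n)
  have h1 : ((n + 1 : ℕ) : ℂ) * ∫ z, f z ∂areaMeasure = ∑ j ∈ Finset.range (n + 1),
      ∫ z, f (rotate (axisRotation (2 * Real.pi * j / (n + 1 : ℕ))) z) ∂areaMeasure := by
    simp_rw [integral_comp_rotate]
    simp
  have hrot : ∀ φ : ℝ, Integrable (fun z => f (rotate (axisRotation φ) z)) areaMeasure := fun φ =>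
    (measurePreserving_rotate (axisRotation φ)).integrable_comp_of_integrable hfint
  rw [h1, ← integral_finsetSum _ fun j _ => hrot _]
  have h2 : ∀ z : S2, ∑ j ∈ Finset.range (n + 1),
      f (rotate (axisRotation (2 * Real.pi * j / (n + 1 : ℕ))) z) =
      ((n + 1 : ℕ) : ℂ) * complexForm a b northPole.1 ^ n *
        ((q (z.1 2) * legendre n (z.1 2) : ℝ) : ℂ) := by
    intro z
    have h3 : ∀ φ : ℝ, (rotate (axisRotation φ) z).1 2 = z.1 2 := fun φ => rfl
    simp only [hf, h3]
    rw [← Finset.mul_sum]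
    have := sum_complexForm_axisRotation_pow (Nat.lt_add_one n) hab h0 z
    simp only [rotate]
    rw [this]
    push_cast
    ring
  simp_rw [h2]
  rw [integral_const_mul, integral_complex_ofReal, mul_assoc]
  rfl

/-- The Funk-Hecke formula, for the spherical harmonics that are powers of an isotropic linear
form. -/
theorem funkHecke {q : ℝ → ℝ} (hq : Integrable (fun z : S2 => q (z.1 2)) areaMeasure)
    (n : ℕ) (x : S2) {a b : EuclideanSpace ℝ (Fin 3)} (hab : ‖a‖ = ‖b‖) (h0 : ⟪a, b⟫_ℝ = 0) :
    ∫ z : S2, (q ⟪x.1, z.1⟫_ℝ : ℂ) * complexForm a b z.1 ^ n ∂areaMeasure =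
      complexForm a b x.1 ^ n * (zonalIntegral q n : ℂ) := by
  obtain ⟨g, hg⟩ := exists_rotate_eq_northPole x
  rw [← integral_comp_rotate g.symm]
  have hinner : ∀ y z, ⟪y, g.symm z⟫_ℝ = ⟪g y, z⟫_ℝ := fun y z => by
    rw [← g.inner_map_map, g.apply_symm_apply]
  have h1 : ∀ z : S2, complexForm a b (rotate g.symm z).1 = complexForm (g a) (g b) z.1 :=
    fun z => by simp only [complexForm, rotate, hinner]
  have h2 : ∀ z : S2, ⟪x.1, (rotate g.symm z).1⟫_ℝ = z.1 2 := fun z => by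
    simp only [rotate, hinner, hg, inner_northPole]
  simp_rw [h1, h2]
  rw [funkHecke_northPole hq n (by simpa using hab) (by simpa using h0)]
  congr 2
  rw [← hg]
  simp [complexForm]

/-- The zonal harmonic with pole `x` is an average of powers of isotropic linear forms. -/
theorem exists_legendre_inner_eq_sum (n : ℕ) (x : S2) :
    ∃ b : ℕ → EuclideanSpace ℝ (Fin 3), (∀ j, ‖x.1‖ = ‖b j‖ ∧ ⟪x.1, b j⟫_ℝ = 0) ∧
      ∀ z : S2, (legendre n ⟪x.1, z.1⟫_ℝ : ℂ) =
        ∑ j ∈ Finset.range (n + 1), ((n + 1 : ℕ) : ℂ)⁻¹ * complexForm x.1 (b j) z.1 ^ n := by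
  obtain ⟨g, hg⟩ := exists_rotate_eq_northPole x
  -- The vectors `b j` are equidistributed on the great circle orthogonal to `x`: points of the
  -- equator carried back by `g`.
  let c : ℝ → EuclideanSpace ℝ (Fin 3) := fun φ => !₂[Real.cos φ, Real.sin φ, 0]
  have hinner : ∀ y z, ⟪g.symm y, z⟫_ℝ = ⟪y, g z⟫_ℝ := fun y z => by
    rw [← g.inner_map_map, g.apply_symm_apply]
  refine ⟨fun j => g.symm (c (2 * Real.pi * j / (n + 1 : ℕ))), fun j => ⟨?_, ?_⟩, fun z => ?_⟩
  · have h1 : ‖x.1‖ = 1 := by simp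
    rw [h1, LinearIsometryEquiv.norm_map, eq_comm, ← sq_eq_sq₀ (norm_nonneg _) zero_le_one,
      EuclideanSpace.real_norm_sq_eq, Fin.sum_univ_three]
    simp [c]
  · rw [real_inner_comm, hinner, hg, real_inner_comm, inner_northPole]
    simp [c]
  · set y : S2 := rotate g z with hy
    have hx : ⟪x.1, z.1⟫_ℝ = y.1 2 := by
      rw [← inner_northPole, ← hg, hy]
      exact (g.inner_map_map _ _).symm
    have hy1 : ((y.1 0 : ℂ)) ^ 2 + (y.1 1 : ℂ) ^ 2 + (y.1 2 : ℂ) ^ 2 = 1 := by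
      have := congrArg Complex.ofReal (sum_sq_eq_one y)
      push_cast at this
      exact this
    have key := sum_add_cos_add_sin_pow (Nat.lt_add_one n) 1 (Complex.I * y.1 0)
      (Complex.I * y.1 1) (y.1 2) (by
        linear_combination ((y.1 0 : ℂ) ^ 2 + (y.1 1 : ℂ) ^ 2) * Complex.I_sq - hy1)
    have hN : ((n + 1 : ℕ) : ℂ) ≠ 0 := by exact_mod_cast n.succ_ne_zero
    rw [hx, ← Finset.mul_sum, eq_inv_mul_iff_mul_eq₀ hN]
    simp only [one_pow, one_mul] at key
    rw [← key]
    refine Finset.sum_congr rfl fun j _ => ?_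
    have hc : ∀ φ, ⟪g.symm (c φ), z.1⟫_ℝ = Real.cos φ * y.1 0 + Real.sin φ * y.1 1 := by
      intro φ
      rw [hinner, PiLp.inner_apply, Fin.sum_univ_three]
      simp [c, hy, rotate]
      ring
    rw [complexForm, hx, hc]
    congr 1
    push_cast
    ring

/-- This admits zonal harmonics as test functions in the definition of the angular power spectrum.
-/
theorem isSphericalHarmonic_legendre (n : ℕ) (x : S2) :
    IsSphericalHarmonic n fun z => (legendre n ⟪x.1, z.1⟫_ℝ : ℂ) := by
  obtain ⟨b, hb, h⟩ := exists_legendre_inner_eq_sum n x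
  simp_rw [h]
  exact .sum fun j _ => (isSphericalHarmonic_complexForm_pow n (hb j).1 (hb j).2).const_mul _

/-- The Funk-Hecke formula for zonal harmonics. -/
theorem integral_mul_legendre {q : ℝ → ℝ}
    (hq : Integrable (fun z : S2 => q (z.1 2)) areaMeasure) (n : ℕ) (x y : S2) :
    ∫ z : S2, q ⟪y.1, z.1⟫_ℝ * legendre n ⟪x.1, z.1⟫_ℝ ∂areaMeasure =
      legendre n ⟪x.1, y.1⟫_ℝ * zonalIntegral q n := by
  obtain ⟨b, hb, h⟩ := exists_legendre_inner_eq_sum n x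
  apply Complex.ofReal_injective
  rw [← integral_complex_ofReal]
  push_cast
  rw [h y, Finset.sum_mul]
  simp_rw [h, Finset.mul_sum]
  rw [integral_finsetSum]
  · refine Finset.sum_congr rfl fun j _ => ?_
    rw [mul_assoc, ← funkHecke hq n y (hb j).1 (hb j).2, ← integral_const_mul]
    refine integral_congr_ae (.of_forall fun z => ?_)
    simp only
    ring
  · intro j _
    refine integrable_ofReal_mul (integrable_inner hq y) ?_
    exact continuous_const.mul (continuous_complexForm_pow _ _ n)

theorem integrable_of_continuous {f : S2 → ℝ} (hf : Continuous f) : Integrable f areaMeasure :=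
  hf.integrable_of_hasCompactSupport (HasCompactSupport.of_compactSpace _)

/-- Archimedes' theorem and the substitution `w = (1 - t)/2` reduce this to orthogonality on `[0,
1]`. -/
theorem zonalIntegral_legendre (m n : ℕ) :
    zonalIntegral (legendre m) n = if m = n then 4 * Real.pi / (2 * n + 1) else 0 := by
  have hc : Continuous fun t => legendre m t * legendre n t :=
    (continuous_legendre m).mul (continuous_legendre n)
  have h1 : zonalIntegral (legendre m) n =
      2 * Real.pi * ∫ t in (-1 : ℝ)..1, legendre m t * legendre n t := by
    have hm : Measurable fun x : S2 => x.1 2 := by fun_prop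
    have := integral_map (μ := areaMeasure) hm.aemeasurable (f := fun t => legendre m t * legendre n t)
      hc.aestronglyMeasurable
    rw [zonalIntegral, ← this, map_coord_areaMeasure, integral_smul_measure,
      intervalIntegral.integral_of_le (by norm_num), integral_Icc_eq_integral_Ioc,
      ENNReal.toReal_ofReal (by positivity), smul_eq_mul]
  have h2 : ∫ t in (-1 : ℝ)..1, legendre m t * legendre n t =
      2 * ∫ w in (0 : ℝ)..1, (realShiftedLegendre m).eval w * (realShiftedLegendre n).eval w := by
    have := intervalIntegral.integral_comp_sub_mul (a := -1) (b := 1)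
      (fun w => (realShiftedLegendre m).eval w * (realShiftedLegendre n).eval w)
      (c := (1 / 2 : ℝ)) (by norm_num) (1 / 2)
    norm_num at this
    rw [← this]
    refine intervalIntegral.integral_congr fun t _ => ?_
    simp only [legendre]
    ring_nf
  rw [h1, h2]
  split_ifs with hmn
  · subst hmn
    simp_rw [← sq]
    rw [realShiftedLegendre.integral_sq]
    ring
  · rw [realShiftedLegendre.integral_mul_of_ne hmn]
    ring

/-- The zonal harmonics are reproducing kernels of mutually orthogonal spaces. -/
theorem integral_legendre_mul_legendre (m n : ℕ) (x y : S2) :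
    ∫ z : S2, legendre m ⟪y.1, z.1⟫_ℝ * legendre n ⟪x.1, z.1⟫_ℝ ∂areaMeasure =
      if m = n then 4 * Real.pi / (2 * n + 1) * legendre n ⟪x.1, y.1⟫_ℝ else 0 := by
  rw [integral_mul_legendre (integrable_of_continuous
    ((continuous_legendre m).comp (by fun_prop))), zonalIntegral_legendre, mul_ite, mul_zero,
    mul_comm]

end SphericalField

/-! ### Isotropic fields and their covariance operator -/

namespace SphericalField

open scoped InnerProductSpace

/-- `SO(3)` acts transitively on the pairs of points of the sphere at a given distance. -/
theorem exists_rotation_pair {x y x' y' : S2} (h : ⟪x.1, y.1⟫_ℝ = ⟪x'.1, y'.1⟫_ℝ) :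
    ∃ g : EuclideanSpace ℝ (Fin 3) ≃ₗᵢ[ℝ] EuclideanSpace ℝ (Fin 3),
      LinearMap.det (g.toLinearEquiv : EuclideanSpace ℝ (Fin 3) →ₗ[ℝ] EuclideanSpace ℝ (Fin 3)) = 1 ∧
      rotate g x = x' ∧ rotate g y = y' := by
  set g₁ := (ℝ ∙ (x.1 - x'.1))ᗮ.reflection with hg₁
  have h1 : g₁ x.1 = x'.1 := Submodule.reflection_sub (by simp)
  set g₂ := (ℝ ∙ (g₁ y.1 - y'.1))ᗮ.reflection with hg₂
  have h2 : g₂ (g₁ y.1) = y'.1 := Submodule.reflection_sub (by simp)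
  have hfix : ∀ v w : EuclideanSpace ℝ (Fin 3), ⟪v, w⟫_ℝ = 0 → (ℝ ∙ w)ᗮ.reflection v = v := by
    intro v w hvw
    refine Submodule.reflection_mem_subspace_eq_self ?_
    rw [Submodule.mem_orthogonal_singleton_iff_inner_left]
    exact hvw
  -- The second mirror contains `x'` because the two pairs have equal inner products.
  have h3 : g₂ x'.1 = x'.1 := hfix _ _ (by
    rw [inner_sub_right, ← h, ← h1, g₁.inner_map_map, sub_self])
  -- Two vectors do not span space. Reflection along a common normal fixes both points and corrects
  -- the determinant when it is `-1`.
  obtain ⟨n, hn, hn0⟩ : ∃ n ∈ (Submodule.span ℝ {x'.1, y'.1})ᗮ, n ≠ 0 := by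
    refine Submodule.exists_mem_ne_zero_of_ne_bot fun hbot => ?_
    have h4 := Submodule.finrank_add_finrank_orthogonal (Submodule.span ℝ {x'.1, y'.1})
    rw [hbot, finrank_bot, finrank_euclideanSpace_fin] at h4
    have h5 := finrank_span_finset_le_card (R := ℝ) {x'.1, y'.1}
    rw [Finset.coe_pair] at h5
    have h6 : ({x'.1, y'.1} : Finset (EuclideanSpace ℝ (Fin 3))).card ≤ 2 := Finset.card_le_two
    simp only [Set.finrank] at h5
    omega
  rw [Submodule.mem_orthogonal] at hn
  set g₃ := (ℝ ∙ n)ᗮ.reflection with hg₃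
  have h4 : g₃ x'.1 = x'.1 := hfix _ _ (hn _ (Submodule.subset_span (by simp)))
  have h5 : g₃ y'.1 = y'.1 := hfix _ _ (hn _ (Submodule.subset_span (by simp)))
  have hd : ∀ K : Submodule ℝ (EuclideanSpace ℝ (Fin 3)), LinearMap.det
      (K.reflection.toLinearEquiv : EuclideanSpace ℝ (Fin 3) →ₗ[ℝ] EuclideanSpace ℝ (Fin 3)) =
      (-1) ^ Module.finrank ℝ Kᗮ := fun K => K.det_reflection
  have hd3 : LinearMap.det
      (g₃.toLinearEquiv : EuclideanSpace ℝ (Fin 3) →ₗ[ℝ] EuclideanSpace ℝ (Fin 3)) = -1 := by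
    rw [hg₃, hd, Submodule.orthogonal_orthogonal, finrank_span_singleton hn0, pow_one]
  have hcomp : ∀ f g : EuclideanSpace ℝ (Fin 3) ≃ₗᵢ[ℝ] EuclideanSpace ℝ (Fin 3), LinearMap.det
      ((f.trans g).toLinearEquiv : EuclideanSpace ℝ (Fin 3) →ₗ[ℝ] EuclideanSpace ℝ (Fin 3)) =
      LinearMap.det (g.toLinearEquiv : EuclideanSpace ℝ (Fin 3) →ₗ[ℝ] EuclideanSpace ℝ (Fin 3)) *
      LinearMap.det (f.toLinearEquiv : EuclideanSpace ℝ (Fin 3) →ₗ[ℝ] EuclideanSpace ℝ (Fin 3)) :=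
    fun f g => by rw [← LinearMap.det_comp]; rfl
  have hd12 := hcomp g₁ g₂
  rw [hg₁, hg₂, hd, hd, ← pow_add, ← hg₂, ← hg₁] at hd12
  rcases neg_one_pow_eq_or ℝ (Module.finrank ℝ (ℝ ∙ (g₁ y.1 - y'.1))ᗮᗮ +
    Module.finrank ℝ (ℝ ∙ (x.1 - x'.1))ᗮᗮ) with hs | hs
  · refine ⟨g₁.trans g₂, by rw [hd12, hs], Subtype.ext ?_, Subtype.ext ?_⟩
    · simp [rotate, h1, h3]
    · simp [rotate, h2]
  · refine ⟨(g₁.trans g₂).trans g₃, by rw [hcomp, hd12, hs, hd3]; norm_num,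
      Subtype.ext ?_, Subtype.ext ?_⟩
    · simp [rotate, h1, h3, h4]
    · simp [rotate, h2, h5]

/-- A meridian of the sphere, parametrized by the height. -/
noncomputable def meridian (t : ℝ) : S2 :=
  ⟨!₂[√(1 - (max (-1) (min t 1)) ^ 2), 0, max (-1) (min t 1)], by
    have h1 : max (-1) (min t 1) ≤ 1 := max_le (by norm_num) (min_le_right _ _)
    have h2 : -1 ≤ max (-1) (min t 1) := le_max_left _ _
    rw [mem_sphere_zero_iff_norm, ← sq_eq_sq₀ (norm_nonneg _) zero_le_one,
      EuclideanSpace.real_norm_sq_eq, Fin.sum_univ_three]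
    simp [Real.sq_sqrt (show 0 ≤ 1 - (max (-1) (min t 1)) ^ 2 by nlinarith)]⟩

theorem continuous_meridian : Continuous meridian := by
  unfold meridian
  refine Continuous.subtype_mk ?_ _
  fun_prop

theorem inner_northPole_meridian (x y : S2) :
    ⟪northPole.1, (meridian ⟪x.1, y.1⟫_ℝ).1⟫_ℝ = ⟪x.1, y.1⟫_ℝ := by
  have h : |⟪x.1, y.1⟫_ℝ| ≤ 1 := by
    have := abs_real_inner_le_norm x.1 y.1
    simpa using this
  rw [inner_northPole]
  simp [meridian, abs_le.1 h]

variable {Ω : Type*} [MeasurableSpace Ω] {P : Measure Ω} {S : S2 → Ω → ℝ}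

/-- The covariance function of a zero-mean field. -/
noncomputable def fieldCov (S : S2 → Ω → ℝ) (P : Measure Ω) (x y : S2) : ℝ :=
  ∫ ω, S x ω * S y ω ∂P

theorem abs_mul_le_sq_add_sq (a b : ℝ) : |a * b| ≤ a ^ 2 + b ^ 2 := by
  rw [abs_mul]
  nlinarith [sq_nonneg (|a| - |b|), sq_abs a, sq_abs b, sq_nonneg a, sq_nonneg b]

/-- A jointly measurable field of unit second moments whose covariance is invariant under
rotations. -/
structure IsUnitField (S : S2 → Ω → ℝ) (P : Measure Ω) : Prop where
  measurable : Measurable fun q : S2 × Ω => S q.1 q.2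
  sq : ∀ x, ∫ ω, S x ω ^ 2 ∂P = 1
  isotropic : IsIsotropic S P

namespace IsUnitField

theorem measurable_apply (h : IsUnitField S P) (x : S2) : Measurable (S x) :=
  h.measurable.comp (measurable_const.prodMk measurable_id)

theorem integrable_sq (h : IsUnitField S P) (x : S2) : Integrable (fun ω => S x ω ^ 2) P := by
  -- A non-integrable function has integral `0` by convention, not `1`.
  by_contra hn
  have := h.sq x
  rw [integral_undef hn] at this
  exact zero_ne_one this

theorem integrable_mul (h : IsUnitField S P) (x y : S2) :
    Integrable (fun ω => S x ω * S y ω) P :=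
  ((h.integrable_sq x).add (h.integrable_sq y)).mono'
    ((h.measurable_apply x).mul (h.measurable_apply y)).aestronglyMeasurable
    (.of_forall fun _ => abs_mul_le_sq_add_sq _ _)

theorem integral_sub_sq (h : IsUnitField S P) (x y : S2) :
    ∫ ω, (S x ω - S y ω) ^ 2 ∂P = 2 - 2 * fieldCov S P x y := by
  have h1 : ∀ ω, (S x ω - S y ω) ^ 2 = (S x ω ^ 2 + S y ω ^ 2) - 2 * (S x ω * S y ω) :=
    fun ω => by ring
  have h2 : Integrable (fun ω => S x ω ^ 2 + S y ω ^ 2) P :=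
    (h.integrable_sq x).add (h.integrable_sq y)
  simp_rw [h1]
  rw [integral_sub h2 ((h.integrable_mul x y).const_mul 2), integral_add (h.integrable_sq x)
    (h.integrable_sq y), h.sq, h.sq, integral_const_mul, fieldCov]
  norm_num

theorem abs_fieldCov_le (h : IsUnitField S P) (x y : S2) : |fieldCov S P x y| ≤ 2 := by
  rw [← Real.norm_eq_abs]
  refine (norm_integral_le_integral_norm _).trans ?_
  have := integral_mono (h.integrable_mul x y).norm
    ((h.integrable_sq x).add (h.integrable_sq y)) (fun ω => abs_mul_le_sq_add_sq (S x ω) (S y ω))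
  refine this.trans_eq ?_
  simp only [Pi.add_apply]
  rw [integral_add (h.integrable_sq x) (h.integrable_sq y), h.sq, h.sq]
  norm_num

theorem fieldCov_eq_of_inner_eq (h : IsUnitField S P) {x y x' y' : S2}
    (hxy : ⟪x.1, y.1⟫_ℝ = ⟪x'.1, y'.1⟫_ℝ) : fieldCov S P x y = fieldCov S P x' y' := by
  obtain ⟨g, hg, rfl, rfl⟩ := exists_rotation_pair hxy
  exact h.isotropic g hg x y

end IsUnitField

/-- The covariance of an isotropic field as a function of the inner product. -/
noncomputable def zonalCov (S : S2 → Ω → ℝ) (P : Measure Ω) (t : ℝ) : ℝ :=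
  fieldCov S P northPole (meridian t)

namespace IsUnitField

theorem fieldCov_eq_zonalCov (h : IsUnitField S P) (x y : S2) :
    fieldCov S P x y = zonalCov S P ⟪x.1, y.1⟫_ℝ :=
  h.fieldCov_eq_of_inner_eq (inner_northPole_meridian x y).symm

/-- Continuity of the covariance is not assumed; joint measurability of the field along a meridian
replaces it. -/
theorem measurable_zonalCov [SFinite P] (h : IsUnitField S P) : Measurable (zonalCov S P) := by
  have hm : Measurable fun q : ℝ × Ω => S northPole q.2 * S (meridian q.1) q.2 :=
    (h.measurable.comp (measurable_const.prodMk measurable_snd)).mul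
      (h.measurable.comp
        ((continuous_meridian.measurable.comp measurable_fst).prodMk measurable_snd))
  exact (hm.stronglyMeasurable.integral_prod_right' (ν := P)).measurable

theorem integrable_zonalCov [SFinite P] (h : IsUnitField S P) :
    Integrable (fun z : S2 => zonalCov S P (z.1 2)) areaMeasure := by
  refine Integrable.of_bound (h.measurable_zonalCov.comp (by fun_prop)).aestronglyMeasurable 2
    (.of_forall fun z => ?_)
  exact h.abs_fieldCov_le _ _

theorem integrable_sq_prod {Z : Type*} [MeasurableSpace Z] {μ : Measure Z} [IsFiniteMeasure μ]
    [SFinite P] (h : IsUnitField S P) {i : Z → S2} (hi : Measurable i) :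
    Integrable (fun q : Ω × Z => S (i q.2) q.1 ^ 2) (P.prod μ) := by
  have hm : Measurable fun q : Ω × Z => S (i q.2) q.1 ^ 2 :=
    (h.measurable.comp ((hi.comp measurable_snd).prodMk measurable_fst)).pow_const 2
  rw [integrable_prod_iff' hm.aestronglyMeasurable]
  refine ⟨.of_forall fun z => h.integrable_sq (i z), ?_⟩
  have : (fun z => ∫ ω, ‖S (i z) ω ^ 2‖ ∂P) = fun _ => (1 : ℝ) := by
    funext z
    rw [← h.sq (i z)]
    exact integral_congr_ae (.of_forall fun ω => by simp)
  simp only [this]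
  exact integrable_const _

theorem integrable_mul_prod {Z : Type*} [MeasurableSpace Z] {μ : Measure Z} [IsFiniteMeasure μ]
    [SFinite P] (h : IsUnitField S P) {i j : Z → S2} (hi : Measurable i) (hj : Measurable j)
    {f : Z → ℝ} (hf : Measurable f) {C : ℝ} (hC : ∀ z, ‖f z‖ ≤ C) :
    Integrable (fun q : Ω × Z => f q.2 * (S (i q.2) q.1 * S (j q.2) q.1)) (P.prod μ) := by
  have hm : ∀ k : Z → S2, Measurable k → Measurable fun q : Ω × Z => S (k q.2) q.1 := fun k hk =>
    h.measurable.comp ((hk.comp measurable_snd).prodMk measurable_fst)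
  have hmul : Integrable (fun q : Ω × Z => S (i q.2) q.1 * S (j q.2) q.1) (P.prod μ) :=
    ((h.integrable_sq_prod hi).add (h.integrable_sq_prod hj)).mono'
      ((hm i hi).mul (hm j hj)).aestronglyMeasurable
      (.of_forall fun _ => abs_mul_le_sq_add_sq _ _)
  exact hmul.bdd_mul (c := C) (hf.comp measurable_snd).aestronglyMeasurable
    (.of_forall fun q => hC q.2)

/-- Fubini's theorem over a general parameter space, needed both for the sphere and for pairs of its
points. -/
theorem integral_mul_prod {Z : Type*} [MeasurableSpace Z] {μ : Measure Z} [IsFiniteMeasure μ]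
    [SFinite P] (h : IsUnitField S P) {i j : Z → S2} (hi : Measurable i) (hj : Measurable j)
    {f : Z → ℝ} (hf : Measurable f) {C : ℝ} (hC : ∀ z, ‖f z‖ ≤ C) :
    ∫ ω, ∫ z, f z * (S (i z) ω * S (j z) ω) ∂μ ∂P = ∫ z, f z * fieldCov S P (i z) (j z) ∂μ := by
  rw [integral_integral_swap (h.integrable_mul_prod hi hj hf hC)]
  simp_rw [integral_const_mul]
  rfl

end IsUnitField

/-- The integral of a field against a continuous weight. -/
noncomputable def weighted {Ω : Type*} (S : S2 → Ω → ℝ) (f : S2 → ℝ) (ω : Ω) : ℝ :=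
  ∫ z, f z * S z ω ∂areaMeasure

/-- The covariance operator. -/
noncomputable def covOp (S : S2 → Ω → ℝ) (P : Measure Ω) (f : S2 → ℝ) (x : S2) : ℝ :=
  ∫ z, f z * fieldCov S P x z ∂areaMeasure

theorem covOp_const_mul (c : ℝ) (f : S2 → ℝ) (x : S2) :
    covOp S P (fun z => c * f z) x = c * covOp S P f x := by
  simp only [covOp, mul_assoc]
  exact integral_const_mul _ _

theorem exists_bound_S2 {f : S2 → ℝ} (hf : Continuous f) : ∃ C, ∀ z, ‖f z‖ ≤ C := by
  obtain ⟨C, hC⟩ := isCompact_univ.exists_bound_of_continuousOn hf.continuousOn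
  exact ⟨C, fun x => hC x (mem_univ x)⟩

namespace IsUnitField

variable [IsProbabilityMeasure P]

theorem apply_mul_weighted {Ω : Type*} {S : S2 → Ω → ℝ} (x : S2) (f : S2 → ℝ) (ω : Ω) :
    S x ω * weighted S f ω = ∫ z, f z * (S x ω * S z ω) ∂areaMeasure := by
  rw [weighted, ← integral_const_mul]
  exact integral_congr_ae (.of_forall fun z => by ring)

theorem weighted_mul_weighted {Ω : Type*} {S : S2 → Ω → ℝ} (f : S2 → ℝ) (ω : Ω) : weighted S f ω * weighted S f ω =
    ∫ p : S2 × S2, f p.1 * f p.2 * (S p.1 ω * S p.2 ω) ∂areaMeasure.prod areaMeasure := by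
  rw [weighted, ← integral_prod_mul]
  exact integral_congr_ae (.of_forall fun z => by ring)

theorem integrable_apply_mul_weighted (h : IsUnitField S P) (x : S2) {f : S2 → ℝ}
    (hf : Continuous f) : Integrable (fun ω => S x ω * weighted S f ω) P := by
  obtain ⟨C, hC⟩ := exists_bound_S2 hf
  simp_rw [apply_mul_weighted]
  exact (h.integrable_mul_prod (μ := areaMeasure) measurable_const measurable_id hf.measurable
    hC).integral_prod_left

theorem integral_apply_mul_weighted (h : IsUnitField S P) (x : S2) {f : S2 → ℝ}
    (hf : Continuous f) : ∫ ω, S x ω * weighted S f ω ∂P = covOp S P f x := by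
  obtain ⟨C, hC⟩ := exists_bound_S2 hf
  simp_rw [apply_mul_weighted]
  exact h.integral_mul_prod (i := fun _ => x) (j := id) measurable_const measurable_id
    hf.measurable hC

theorem integrable_weighted_mul_weighted (h : IsUnitField S P) {f : S2 → ℝ}
    (hf : Continuous f) : Integrable (fun ω => weighted S f ω * weighted S f ω) P := by
  have hf2 : Continuous fun p : S2 × S2 => f p.1 * f p.2 := by fun_prop
  obtain ⟨C, hC⟩ := isCompact_univ.exists_bound_of_continuousOn hf2.continuousOn
  simp_rw [weighted_mul_weighted]
  exact (h.integrable_mul_prod (μ := areaMeasure.prod areaMeasure) measurable_fst measurable_snd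
    hf2.measurable (fun p => hC p (mem_univ p))).integral_prod_left

theorem integral_weighted_mul_weighted (h : IsUnitField S P) {f : S2 → ℝ}
    (hf : Continuous f) :
    ∫ ω, weighted S f ω * weighted S f ω ∂P = ∫ x, f x * covOp S P f x ∂areaMeasure := by
  have hf2 : Continuous fun p : S2 × S2 => f p.1 * f p.2 := by fun_prop
  obtain ⟨C, hC⟩ := isCompact_univ.exists_bound_of_continuousOn hf2.continuousOn
  simp_rw [weighted_mul_weighted]
  rw [h.integral_mul_prod (μ := areaMeasure.prod areaMeasure) measurable_fst measurable_snd
    hf2.measurable (fun p => hC p (mem_univ p)), integral_prod]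
  · refine integral_congr_ae (.of_forall fun x => ?_)
    simp only [covOp]
    rw [← integral_const_mul]
    exact integral_congr_ae (.of_forall fun z => by ring)
  · have hm : Measurable fun p : S2 × S2 => f p.1 * f p.2 * fieldCov S P p.1 p.2 := by
      refine hf2.measurable.mul ?_
      simp_rw [h.fieldCov_eq_zonalCov]
      exact h.measurable_zonalCov.comp (by fun_prop)
    refine Integrable.of_bound hm.aestronglyMeasurable (C * 2) (.of_forall fun p => ?_)
    rw [norm_mul]
    exact mul_le_mul (hC p (mem_univ p)) (h.abs_fieldCov_le _ _) (norm_nonneg _)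
      ((norm_nonneg _).trans (hC p (mem_univ p)))

/-- Zonal harmonics are eigenfunctions of the covariance operator. -/
theorem covOp_legendre (h : IsUnitField S P) (n : ℕ) (x y : S2) :
    covOp S P (fun z => legendre n ⟪x.1, z.1⟫_ℝ) y =
      zonalIntegral (zonalCov S P) n * legendre n ⟪x.1, y.1⟫_ℝ := by
  rw [mul_comm, ← integral_mul_legendre h.integrable_zonalCov, covOp]
  simp_rw [h.fieldCov_eq_zonalCov]
  exact integral_congr_ae (.of_forall fun z => mul_comm _ _)

/-- The variance of an increment dominates that of the projection of the increment to the
coefficient of a continuous weight. -/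
theorem two_mul_sub_le (h : IsUnitField S P) (x y : S2) {f : S2 → ℝ} (hf : Continuous f) :
    2 * (covOp S P f x - covOp S P f y) - ∫ z, f z * covOp S P f z ∂areaMeasure ≤
      2 - 2 * fieldCov S P x y := by
  have hx := h.integrable_apply_mul_weighted x hf
  have hy := h.integrable_apply_mul_weighted y hf
  have hw := h.integrable_weighted_mul_weighted hf
  have hsq : Integrable (fun ω => (S x ω - S y ω) ^ 2) P := by
    have := ((h.integrable_sq x).add (h.integrable_sq y)).sub ((h.integrable_mul x y).const_mul 2)
    refine this.congr (.of_forall fun ω => ?_)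
    simp only [Pi.add_apply, Pi.sub_apply]
    ring
  -- The claim is the expansion of this square, the distance of the increment from the weighted
  -- integral.
  have h0 : 0 ≤ ∫ ω, (S x ω - S y ω - weighted S f ω) ^ 2 ∂P :=
    integral_nonneg fun ω => sq_nonneg _
  have h1 : ∀ ω, (S x ω - S y ω - weighted S f ω) ^ 2 = ((S x ω - S y ω) ^ 2 -
      2 * (S x ω * weighted S f ω - S y ω * weighted S f ω)) +
      weighted S f ω * weighted S f ω := fun ω => by ring
  simp_rw [h1] at h0
  have hxy : Integrable (fun ω => S x ω * weighted S f ω - S y ω * weighted S f ω) P := hx.sub hy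
  have h2 : Integrable (fun ω => (S x ω - S y ω) ^ 2 -
      2 * (S x ω * weighted S f ω - S y ω * weighted S f ω)) P := hsq.sub (hxy.const_mul 2)
  rw [integral_add h2 hw, integral_sub hsq (hxy.const_mul 2), integral_const_mul,
    integral_sub hx hy, h.integral_sub_sq, h.integral_apply_mul_weighted x hf,
    h.integral_apply_mul_weighted y hf, h.integral_weighted_mul_weighted hf] at h0
  linarith

theorem covOp_finset_sum (h : IsUnitField S P) {ι : Type*} (s : Finset ι) {f : ι → S2 → ℝ}
    (hf : ∀ i ∈ s, Continuous (f i)) (x : S2) :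
    covOp S P (fun z => ∑ i ∈ s, f i z) x = ∑ i ∈ s, covOp S P (f i) x := by
  simp only [covOp, Finset.sum_mul]
  refine integral_finsetSum _ fun i hi => ?_
  obtain ⟨C, hC⟩ := exists_bound_S2 (hf i hi)
  have hint : Integrable (fun z => fieldCov S P x z) areaMeasure := by
    simp_rw [h.fieldCov_eq_zonalCov]
    exact integrable_inner h.integrable_zonalCov x
  exact hint.bdd_mul (hf i hi).aestronglyMeasurable (.of_forall hC)

theorem covOp_sub (h : IsUnitField S P) {f g : S2 → ℝ} (hf : Continuous f) (hg : Continuous g)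
    (x : S2) : covOp S P (fun z => f z - g z) x = covOp S P f x - covOp S P g x := by
  have hint : Integrable (fun z => fieldCov S P x z) areaMeasure := by
    simp_rw [h.fieldCov_eq_zonalCov]
    exact integrable_inner h.integrable_zonalCov x
  obtain ⟨C, hC⟩ := exists_bound_S2 hf
  obtain ⟨D, hD⟩ := exists_bound_S2 hg
  simp only [covOp, sub_mul]
  exact integral_sub (hint.bdd_mul hf.aestronglyMeasurable (.of_forall hC))
    (hint.bdd_mul hg.aestronglyMeasurable (.of_forall hD))

end IsUnitField

/-! ### Spectral lower bound for the variance of increments -/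

theorem continuous_legendre_inner (n : ℕ) (x : S2) :
    Continuous fun z : S2 => legendre n ⟪x.1, z.1⟫_ℝ :=
  (continuous_legendre n).comp (by fun_prop)

/-- The difference of the zonal harmonics with poles `x` and `y`. -/
noncomputable def zonalDiff (x y : S2) (n : ℕ) (z : S2) : ℝ :=
  legendre n ⟪x.1, z.1⟫_ℝ - legendre n ⟪y.1, z.1⟫_ℝ

theorem continuous_zonalDiff (x y : S2) (n : ℕ) : Continuous (zonalDiff x y n) :=
  (continuous_legendre_inner n x).sub (continuous_legendre_inner n y)

theorem inner_self_S2 (x : S2) : ⟪x.1, x.1⟫_ℝ = 1 := by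
  rw [real_inner_self_eq_norm_sq]
  simp

theorem zonalDiff_sub_zonalDiff (x y : S2) (n : ℕ) :
    zonalDiff x y n x - zonalDiff x y n y = 2 * (1 - legendre n ⟪x.1, y.1⟫_ℝ) := by
  simp only [zonalDiff, inner_self_S2, legendre_one, real_inner_comm]
  ring

theorem integral_zonalDiff_mul (x y : S2) (m n : ℕ) :
    ∫ z, zonalDiff x y m z * zonalDiff x y n z ∂areaMeasure =
      if m = n then 4 * Real.pi / (2 * n + 1) * (2 * (1 - legendre n ⟪x.1, y.1⟫_ℝ)) else 0 := by
  have hint : ∀ u v : S2, Integrable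
      (fun z : S2 => legendre m ⟪u.1, z.1⟫_ℝ * legendre n ⟪v.1, z.1⟫_ℝ) areaMeasure := fun u v =>
    integrable_of_continuous ((continuous_legendre_inner m u).mul (continuous_legendre_inner n v))
  have h1 : ∀ z, zonalDiff x y m z * zonalDiff x y n z =
      (legendre m ⟪x.1, z.1⟫_ℝ * legendre n ⟪x.1, z.1⟫_ℝ -
        legendre m ⟪x.1, z.1⟫_ℝ * legendre n ⟪y.1, z.1⟫_ℝ) -
      (legendre m ⟪y.1, z.1⟫_ℝ * legendre n ⟪x.1, z.1⟫_ℝ -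
        legendre m ⟪y.1, z.1⟫_ℝ * legendre n ⟪y.1, z.1⟫_ℝ) := fun z => by
    simp only [zonalDiff]
    ring
  have hsub : ∀ u : S2, Integrable (fun z : S2 => legendre m ⟪u.1, z.1⟫_ℝ * legendre n ⟪x.1, z.1⟫_ℝ -
      legendre m ⟪u.1, z.1⟫_ℝ * legendre n ⟪y.1, z.1⟫_ℝ) areaMeasure := fun u =>
    (hint u x).sub (hint u y)
  simp_rw [h1]
  rw [integral_sub (hsub x) (hsub y), integral_sub (hint x x) (hint x y), integral_sub (hint y x) (hint y y)]
  simp only [integral_legendre_mul_legendre, inner_self_S2, legendre_one, real_inner_comm]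
  split_ifs <;> ring

namespace IsUnitField

variable [IsProbabilityMeasure P]

theorem covOp_zonalDiff (h : IsUnitField S P) (x y z : S2) (n : ℕ) :
    covOp S P (zonalDiff x y n) z = zonalIntegral (zonalCov S P) n * zonalDiff x y n z := by
  have := h.covOp_sub (continuous_legendre_inner n x) (continuous_legendre_inner n y) z
  rw [h.covOp_legendre, h.covOp_legendre] at this
  unfold zonalDiff
  rw [this]
  ring

/-- The variance of an increment is at least every partial sum of its Legendre series. -/
theorem sum_le_two_sub (h : IsUnitField S P) (x y : S2) (s : Finset ℕ) :
    ∑ n ∈ s, zonalIntegral (zonalCov S P) n * ((2 * n + 1) / (4 * Real.pi)) *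
      (2 * (1 - legendre n ⟪x.1, y.1⟫_ℝ)) ≤ 2 - 2 * fieldCov S P x y := by
  set lam := zonalIntegral (zonalCov S P) with hlam
  set c : ℕ → ℝ := fun n => (2 * n + 1) / (4 * Real.pi) with hc
  -- As `c n` is the reciprocal squared norm of a zonal harmonic, integration against `f` projects
  -- the increment to the degrees in `s`. The linear and quadratic terms of `two_mul_sub_le` then
  -- both reduce to the partial sum `Σ`, leaving `2Σ - Σ`.
  set f : S2 → ℝ := fun z => ∑ n ∈ s, c n * zonalDiff x y n z with hf
  have hcont : ∀ n ∈ s, Continuous fun z => c n * zonalDiff x y n z := fun n _ =>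
    continuous_const.mul (continuous_zonalDiff x y n)
  have hfc : Continuous f := continuous_finsetSum _ hcont
  have hop : ∀ z, covOp S P f z = ∑ n ∈ s, c n * (lam n * zonalDiff x y n z) := by
    intro z
    rw [hf, h.covOp_finset_sum s hcont]
    refine Finset.sum_congr rfl fun n _ => ?_
    rw [covOp_const_mul, h.covOp_zonalDiff]
  have h1 : covOp S P f x - covOp S P f y =
      ∑ n ∈ s, lam n * c n * (2 * (1 - legendre n ⟪x.1, y.1⟫_ℝ)) := by
    rw [hop, hop, ← Finset.sum_sub_distrib]
    refine Finset.sum_congr rfl fun n _ => ?_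
    rw [← zonalDiff_sub_zonalDiff]
    ring
  have h2 : ∫ z, f z * covOp S P f z ∂areaMeasure =
      ∑ n ∈ s, lam n * c n * (2 * (1 - legendre n ⟪x.1, y.1⟫_ℝ)) := by
    simp_rw [hop, hf, Finset.sum_mul_sum]
    have hint : ∀ m n, Integrable (fun z => c m * zonalDiff x y m z *
        (c n * (lam n * zonalDiff x y n z))) areaMeasure := fun m n =>
      integrable_of_continuous (by
        have := continuous_zonalDiff x y m
        have := continuous_zonalDiff x y n
        fun_prop)
    rw [integral_finsetSum _ fun m _ => integrable_finsetSum _ fun n _ => hint m n]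
    refine Finset.sum_congr rfl fun m hm => ?_
    rw [integral_finsetSum _ fun n _ => hint m n]
    have h3 : ∀ n, ∫ z, c m * zonalDiff x y m z * (c n * (lam n * zonalDiff x y n z)) ∂areaMeasure =
        if m = n then lam m * c m * (2 * (1 - legendre m ⟪x.1, y.1⟫_ℝ)) else 0 := by
      intro n
      have h4 : ∀ z, c m * zonalDiff x y m z * (c n * (lam n * zonalDiff x y n z)) =
          c m * c n * lam n * (zonalDiff x y m z * zonalDiff x y n z) := fun z => by ring
      simp_rw [h4]
      rw [integral_const_mul, integral_zonalDiff_mul]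
      split_ifs with hmn
      · subst hmn
        simp only [hc]
        have hpi := Real.pi_pos
        field_simp
      · rw [mul_zero]
    simp_rw [h3]
    rw [Finset.sum_ite_eq, if_pos hm]
  have := h.two_mul_sub_le x y hfc
  rw [h1, h2] at this
  linarith

/-- The multipliers of the covariance kernel are the angular power spectrum. -/
theorem zonalIntegral_zonalCov (h : IsUnitField S P) {C : ℕ → ℝ}
    (hC : IsAngularPowerSpectrum S P C) (n : ℕ) : zonalIntegral (zonalCov S P) n = C n := by
  set f : S2 → ℝ := fun z => legendre n ⟪northPole.1, z.1⟫_ℝ with hf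
  have hfc : Continuous f := continuous_legendre_inner n northPole
  have hY := isSphericalHarmonic_legendre n northPole
  have h1 := hC n n _ _ hY hY
  rw [if_pos rfl] at h1
  have hcoeff : ∀ ω, coeff S (fun z => (legendre n ⟪northPole.1, z.1⟫_ℝ : ℂ)) ω =
      (weighted S f ω : ℂ) := by
    intro ω
    rw [coeff, weighted, ← integral_complex_ofReal]
    refine integral_congr_ae (.of_forall fun z => ?_)
    simp [hf, mul_comm]
  have hsq : ∫ z, f z * f z ∂areaMeasure = 4 * Real.pi / (2 * n + 1) := by
    rw [integral_legendre_mul_legendre, if_pos rfl, inner_self_S2, legendre_one, mul_one]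
  simp_rw [hcoeff, Complex.conj_ofReal, ← Complex.ofReal_mul] at h1
  rw [integral_complex_ofReal, integral_complex_ofReal, ← Complex.ofReal_mul] at h1
  have h2 := Complex.ofReal_injective h1
  -- The variance of the zonal coefficient is `C n` times the squared norm of `f` by definition of
  -- the spectrum, and the multiplier times the same norm by the eigenfunction property.
  have h3 : ∀ x, covOp S P f x = zonalIntegral (zonalCov S P) n * f x := h.covOp_legendre n _
  rw [h.integral_weighted_mul_weighted hfc] at h2
  simp_rw [h3, mul_left_comm (f _)] at h2
  rw [integral_const_mul] at h2
  change _ = C n * ∫ z, f z * f z ∂areaMeasure at h2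
  rw [hsq] at h2
  exact mul_right_cancel₀ (by have := Real.pi_pos; positivity) h2

/-- If `C n` is at least of order `n ^ (-α)`, the variance of an increment is at least of order
`α - 2` in the distance. -/
theorem exists_rpow_le_two_sub (h : IsUnitField S P) {C : ℕ → ℝ}
    (hC : IsAngularPowerSpectrum S P C) {α K : ℝ} (hα2 : 2 < α) (hα4 : α < 4) (hK : 1 ≤ K)
    (hCK : ∀ n : ℕ, 1 ≤ n → K⁻¹ * (n : ℝ) ^ (-α) ≤ C n) :
    ∃ c : ℝ, 0 < c ∧ ∀ x y : S2,
      c * ((1 - ⟪x.1, y.1⟫_ℝ) / 2) ^ ((α - 2) / 2) ≤ 2 - 2 * fieldCov S P x y := by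
  have hpi := Real.pi_pos
  have hK0 : 0 < K := by linarith
  -- The constant comes from the case `w ≤ 1/2`, where `w = 1/(2r²)`; the other case leaves room.
  refine ⟨(32 * Real.pi * K)⁻¹, by positivity, fun x y => ?_⟩
  have habs : |⟪x.1, y.1⟫_ℝ| ≤ 1 := by simpa using abs_real_inner_le_norm x.1 y.1
  set w := (1 - ⟪x.1, y.1⟫_ℝ) / 2 with hw
  have hw0 : 0 ≤ w := by have := (abs_le.1 habs).2; linarith
  have hw1 : w ≤ 1 := by have := (abs_le.1 habs).1; linarith
  have hsum := h.sum_le_two_sub x y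
  simp_rw [h.zonalIntegral_zonalCov hC] at hsum
  have hleg : ∀ n, legendre n ⟪x.1, y.1⟫_ℝ = (realShiftedLegendre n).eval w := fun n => rfl
  simp_rw [hleg] at hsum
  rcases hw0.eq_or_lt with hw00 | hwpos
  · rw [← hw00, Real.zero_rpow (by linarith : (α - 2) / 2 ≠ 0), mul_zero]
    simpa using hsum ∅
  have hterm : ∀ n : ℕ, 1 ≤ n → (n : ℝ) * (n + 1) * w ≤ 1 →
      w / (2 * Real.pi * K) * ((n : ℝ) * (n : ℝ) ^ (2 - α)) ≤
      C n * ((2 * n + 1) / (4 * Real.pi)) * (2 * (1 - (realShiftedLegendre n).eval w)) := by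
    intro n hn hnw
    have hn0 : (0 : ℝ) < n := by exact_mod_cast hn
    have h1 := realShiftedLegendre.le_one_sub_eval hw0 hnw
    have h2 : (n : ℝ) ^ (2 - α) = (n : ℝ) ^ 2 * (n : ℝ) ^ (-α) := by
      rw [sub_eq_add_neg, Real.rpow_add hn0, Real.rpow_two]
    have h3 : 0 ≤ (n : ℝ) ^ (-α) := by positivity
    calc w / (2 * Real.pi * K) * ((n : ℝ) * (n : ℝ) ^ (2 - α))
        = K⁻¹ * (n : ℝ) ^ (-α) * (2 * n / (4 * Real.pi)) * (2 * (n ^ 2 * w / 2)) := by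
          rw [h2]
          field_simp
          ring
      _ ≤ C n * ((2 * n + 1) / (4 * Real.pi)) * (2 * (1 - (realShiftedLegendre n).eval w)) := by
          have h4 : (n : ℝ) ^ 2 * w / 2 ≤ 1 - (realShiftedLegendre n).eval w := by
            refine le_trans ?_ h1
            nlinarith
          have h5 : 0 ≤ C n := le_trans (by positivity) (hCK n hn)
          have h6 := hCK n hn
          gcongr
          linarith
  rcases le_or_gt w (1 / 2) with hwh | hwh
  -- The cutoff is chosen so that `n(n+1)w ≤ 2n²w ≤ 1` for `1 ≤ n ≤ r`. As `w ≤ 1/2`, its floor `L`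
  -- is at least `1` and at least `r/2`.
  · set r := (√(2 * w))⁻¹ with hr
    have hr0 : 0 < r := by positivity
    have hr1 : 1 ≤ r := by
      rw [hr, one_le_inv₀ (by positivity), Real.sqrt_le_iff]
      constructor <;> linarith
    have hr2 : r ^ 2 = 1 / (2 * w) := by
      rw [hr, inv_pow, Real.sq_sqrt (by positivity), one_div]
    have hwr : w = 1 / (2 * r ^ 2) := by rw [hr2]; field_simp
    set L := ⌊r⌋₊ with hL
    have hLr : (L : ℝ) ≤ r := Nat.floor_le hr0.le
    have hL1 : 1 ≤ L := Nat.one_le_floor_iff r |>.2 hr1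
    have hL1' : (1 : ℝ) ≤ L := by exact_mod_cast hL1
    have hLr2 : r / 2 ≤ L := by
      have := Nat.lt_floor_add_one r
      linarith
    have hLsum : (L : ℝ) ^ 2 / 2 ≤ ∑ n ∈ Finset.Icc 1 L, (n : ℝ) := by
      have : ∀ M : ℕ, ∑ n ∈ Finset.Icc 1 M, (n : ℝ) = M * (M + 1) / 2 := by
        intro M
        induction M with
        | zero => simp
        | succ M ih =>
          rw [Finset.sum_Icc_succ_top (by omega), ih]
          push_cast
          ring
      rw [this]
      nlinarith
    have hnw : ∀ n ∈ Finset.Icc 1 L, (n : ℝ) * (n + 1) * w ≤ 1 := by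
      intro n hn
      obtain ⟨hn1, hnL⟩ := Finset.mem_Icc.1 hn
      have hn1' : (1 : ℝ) ≤ n := by exact_mod_cast hn1
      have hnr : (n : ℝ) ≤ r := le_trans (by exact_mod_cast hnL) hLr
      have h2w : 2 * w * r ^ 2 = 1 := by rw [hr2]; field_simp
      have : (n : ℝ) * (n + 1) ≤ 2 * r ^ 2 := by nlinarith
      nlinarith
    have hbig : w / (2 * Real.pi * K) * ((L : ℝ) ^ (2 - α) * (L ^ 2 / 2)) ≤
        2 - 2 * fieldCov S P x y := by
      refine le_trans ?_ (hsum (Finset.Icc 1 L))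
      refine le_trans ?_ (Finset.sum_le_sum fun n hn => hterm n (Finset.mem_Icc.1 hn).1 (hnw n hn))
      rw [← Finset.mul_sum]
      refine mul_le_mul_of_nonneg_left ?_ (by positivity)
      calc (L : ℝ) ^ (2 - α) * (L ^ 2 / 2) ≤ (L : ℝ) ^ (2 - α) * ∑ n ∈ Finset.Icc 1 L, (n : ℝ) := by
            gcongr
        _ = ∑ n ∈ Finset.Icc 1 L, (n : ℝ) * (L : ℝ) ^ (2 - α) := by
            rw [Finset.mul_sum]
            exact Finset.sum_congr rfl fun n _ => mul_comm _ _
        _ ≤ _ := by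
            refine Finset.sum_le_sum fun n hn => ?_
            obtain ⟨hn1, hnL⟩ := Finset.mem_Icc.1 hn
            refine mul_le_mul_of_nonneg_left ?_ (by positivity)
            exact Real.rpow_le_rpow_of_nonpos (by exact_mod_cast hn1) (by exact_mod_cast hnL)
              (by linarith)
    refine le_trans ?_ hbig
    have h1 : (L : ℝ) ^ (2 - α) * (L ^ 2 / 2) = (L : ℝ) ^ (4 - α) / 2 := by
      have : (L : ℝ) ^ (4 - α) = (L : ℝ) ^ (2 - α) * L ^ 2 := by
        rw [← Real.rpow_two, ← Real.rpow_add (by linarith)]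
        congr 1
        ring
      rw [this]
      ring
    have h2 : r ^ (4 - α) / 4 ≤ (L : ℝ) ^ (4 - α) := by
      have h3 : (r / 2) ^ (4 - α) ≤ (L : ℝ) ^ (4 - α) :=
        Real.rpow_le_rpow (by positivity) hLr2 (by linarith)
      refine le_trans ?_ h3
      rw [Real.div_rpow hr0.le (by norm_num)]
      have h4 : (2 : ℝ) ^ (4 - α) ≤ (2 : ℝ) ^ (2 : ℝ) :=
        Real.rpow_le_rpow_of_exponent_le (by norm_num) (by linarith)
      have h5 : (2 : ℝ) ^ (2 : ℝ) = 4 := by norm_num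
      rw [h5] at h4
      gcongr
    have h3 : w ^ ((α - 2) / 2) ≤ r ^ (2 - α) := by
      have h4 : w ≤ (r ^ 2)⁻¹ := by
        rw [hr2, one_div, inv_inv]
        linarith
      refine (Real.rpow_le_rpow hw0 h4 (by linarith)).trans_eq ?_
      rw [← Real.rpow_two, ← Real.rpow_neg hr0.le, ← Real.rpow_mul hr0.le]
      congr 1
      ring
    have h6 : r ^ (4 - α) = r ^ (2 - α) * r ^ 2 := by
      rw [← Real.rpow_two, ← Real.rpow_add hr0]
      congr 1
      ring
    calc (32 * Real.pi * K)⁻¹ * w ^ ((α - 2) / 2) ≤ (32 * Real.pi * K)⁻¹ * r ^ (2 - α) := by gcongr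
      _ = 1 / (2 * r ^ 2) / (2 * Real.pi * K) * (r ^ (4 - α) / 4 / 2) := by
          rw [h6]
          field_simp
          norm_num
      _ ≤ w / (2 * Real.pi * K) * ((L : ℝ) ^ (2 - α) * (L ^ 2 / 2)) := by
          rw [h1, ← hwr]
          gcongr
  -- For points this far apart degree one is enough: its Legendre deficit is `2w > 1`.
  · refine le_trans ?_ (hsum {1})
    rw [Finset.sum_singleton]
    have h1 : (realShiftedLegendre 1).eval w = 1 - 2 * w := by
      rw [realShiftedLegendre.eval_eq_sum]
      simp [Finset.sum_range_succ]
      ring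
    have h2 := hCK 1 le_rfl
    simp only [Nat.cast_one, Real.one_rpow, mul_one] at h2 ⊢
    have h3 : w ^ ((α - 2) / 2) ≤ 1 := Real.rpow_le_one hw0 hw1 (by linarith)
    calc (32 * Real.pi * K)⁻¹ * w ^ ((α - 2) / 2) ≤ (32 * Real.pi * K)⁻¹ * 1 := by gcongr
      _ = K⁻¹ * (1 / (32 * Real.pi)) := by field_simp
      _ ≤ C 1 * ((2 + 1) / (4 * Real.pi)) := by
          gcongr
          · linarith [inv_pos.2 hK0]
          · norm_num
          · linarith
      _ ≤ C 1 * ((2 + 1) / (4 * Real.pi)) * (2 * (1 - (realShiftedLegendre 1).eval w)) := by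
          have h4 : 0 ≤ C 1 * ((2 + 1) / (4 * Real.pi)) := by
            have : 0 < K⁻¹ := inv_pos.2 hK0
            have : 0 ≤ C 1 := by linarith
            positivity
          rw [h1]
          nlinarith

end IsUnitField

end SphericalField

/-! ### Small-ball estimates for the increments -/

/-- A centred Gaussian of variance `v` charges a ball of radius `ε` by at most `ε / √v`. -/
theorem gaussianReal_abs_le_le {v : NNReal} (hv : v ≠ 0) {ε : ℝ} (hε : 0 < ε) :
    gaussianReal 0 v {x | |x| ≤ ε} ≤ ENNReal.ofReal (ε * (√(v : ℝ))⁻¹) := by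
  have hv0 : (0 : ℝ) < v := by positivity
  have hs : {x : ℝ | |x| ≤ ε} = Icc (-ε) ε := by
    ext x
    simp [abs_le]
  have hpdf : ∀ x, gaussianPDF 0 v x ≤ ENNReal.ofReal ((2 * √(v : ℝ))⁻¹) := by
    intro x
    rw [gaussianPDF_def]
    refine ENNReal.ofReal_le_ofReal ?_
    rw [gaussianPDFReal_def]
    have h1 : Real.exp (-(x - 0) ^ 2 / (2 * v)) ≤ 1 := by
      rw [Real.exp_le_one_iff, neg_div, neg_nonpos]
      positivity
    -- From `2π ≥ 4`; the factor `2` cancels the length `2ε` of the interval.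
    have h2 : 2 * √(v : ℝ) ≤ √(2 * Real.pi * v) := by
      refine Real.le_sqrt_of_sq_le ?_
      rw [mul_pow, Real.sq_sqrt hv0.le]
      nlinarith [Real.pi_gt_three]
    calc (√(2 * Real.pi * v))⁻¹ * Real.exp (-(x - 0) ^ 2 / (2 * v))
        ≤ (√(2 * Real.pi * v))⁻¹ * 1 := by gcongr
      _ ≤ (2 * √(v : ℝ))⁻¹ := by
        rw [mul_one]
        gcongr
  rw [gaussianReal_apply _ hv, hs]
  calc ∫⁻ x in Icc (-ε) ε, gaussianPDF 0 v x
      ≤ ∫⁻ _ in Icc (-ε) ε, ENNReal.ofReal ((2 * √(v : ℝ))⁻¹) := lintegral_mono hpdf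
    _ = ENNReal.ofReal ((2 * √(v : ℝ))⁻¹) * ENNReal.ofReal (ε - -ε) := by
        rw [lintegral_const, Measure.restrict_apply_univ, Real.volume_Icc]
    _ = ENNReal.ofReal (ε * (√(v : ℝ))⁻¹) := by
        rw [← ENNReal.ofReal_mul (by positivity)]
        congr 1
        have : 0 < √(v : ℝ) := by positivity
        field_simp
        ring

namespace SphericalField

open scoped InnerProductSpace

variable {Ω Ω₀ : Type*} [MeasurableSpace Ω] [MeasurableSpace Ω₀]

/-- A field satisfying condition (A) has a jointly measurable modification on an almost sure event,
with the same second-order structure. -/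
theorem ConditionA.exists_isUnitField {T₀ : S2 → Ω₀ → ℝ} {P₀ : Measure Ω₀} {α : ℝ}
    (h : ConditionA T₀ P₀ α) : ∃ S : S2 → Ω₀ → ℝ, IsUnitField S P₀ ∧
      (∀ᵐ ω ∂P₀, ∀ x, T₀ x ω = S x ω) ∧
      ∀ C, IsAngularPowerSpectrum T₀ P₀ C → IsAngularPowerSpectrum S P₀ C := by
  obtain ⟨S, hS, hTS⟩ := h.measurable
  refine ⟨S, ⟨hS, fun x => ?_, fun g hg x y => ?_⟩, hTS, fun C hC ℓ ℓ' Y Y' hY hY' => ?_⟩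
  · rw [← h.unit_variance x]
    refine integral_congr_ae ?_
    filter_upwards [hTS] with ω hω
    rw [hω]
  · have h1 : ∀ x y, ∫ ω, S x ω * S y ω ∂P₀ = ∫ ω, T₀ x ω * T₀ y ω ∂P₀ := by
      intro x y
      refine integral_congr_ae ?_
      filter_upwards [hTS] with ω hω
      rw [hω, hω]
    rw [h1, h1]
    exact h.isotropic g hg x y
  · rw [← hC ℓ ℓ' Y Y' hY hY']
    refine integral_congr_ae ?_
    filter_upwards [hTS] with ω hω
    simp only [coeff, hω]

/-- The lower bound for the variance of the increments of a field satisfying condition (A). -/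
theorem ConditionA.exists_rpow_le_variance {T₀ : S2 → Ω₀ → ℝ} {P₀ : Measure Ω₀}
    [IsProbabilityMeasure P₀] {α : ℝ} (h : ConditionA T₀ P₀ α) (hα : α < 4) :
    ∃ c : ℝ, 0 < c ∧ ∀ x y : S2, c * ((1 - ⟪x.1, y.1⟫_ℝ) / 2) ^ ((α - 2) / 2) ≤
      Var[fun ω => T₀ x ω - T₀ y ω; P₀] := by
  obtain ⟨S, hS, hTS, hC⟩ := h.exists_isUnitField
  obtain ⟨C, hC', G, K, hK, hG⟩ := h.spectrum
  obtain ⟨c, hc, hcx⟩ := hS.exists_rpow_le_two_sub (hC C hC') h.two_lt hα hK (fun n hn => by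
    obtain ⟨h1, -, h2⟩ := hG n hn
    rw [h2]
    gcongr)
  refine ⟨c, hc, fun x y => (hcx x y).trans_eq ?_⟩
  have hL : HasGaussianLaw (fun ω => T₀ x ω - T₀ y ω) P₀ := h.gaussian.hasGaussianLaw_fun_sub
  have hmean : ∫ ω, (T₀ x ω - T₀ y ω) ∂P₀ = 0 := by
    rw [integral_sub (h.gaussian.hasGaussianLaw_eval x).integrable
      (h.gaussian.hasGaussianLaw_eval y).integrable, h.mean_zero, h.mean_zero, sub_zero]
  rw [variance_of_integral_eq_zero hL.aemeasurable hmean, ← hS.integral_sub_sq]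
  refine integral_congr_ae ?_
  filter_upwards [hTS] with ω hω
  simp [hω]

/-- The increment is a centred Gaussian, and the small-ball bound decreases with its variance. -/
theorem ConditionA.measure_abs_sub_le {T₀ : S2 → Ω₀ → ℝ} {P₀ : Measure Ω₀}
    [IsProbabilityMeasure P₀] {α : ℝ} (h : ConditionA T₀ P₀ α) {x y : S2} {v : ℝ} (hv : 0 < v)
    (hvar : v ≤ Var[fun ω => T₀ x ω - T₀ y ω; P₀]) {ε : ℝ} (hε : 0 < ε) :
    P₀ {ω | |T₀ x ω - T₀ y ω| ≤ ε} ≤ ENNReal.ofReal (ε * (√v)⁻¹) := by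
  have hL : HasGaussianLaw (fun ω => T₀ x ω - T₀ y ω) P₀ := h.gaussian.hasGaussianLaw_fun_sub
  have hmean : ∫ ω, (T₀ x ω - T₀ y ω) ∂P₀ = 0 := by
    rw [integral_sub (h.gaussian.hasGaussianLaw_eval x).integrable
      (h.gaussian.hasGaussianLaw_eval y).integrable, h.mean_zero, h.mean_zero, sub_zero]
  have hms : MeasurableSet {x : ℝ | |x| ≤ ε} := measurableSet_le measurable_abs measurable_const
  have h1 := hL.map_eq_gaussianReal
  rw [hmean] at h1
  have h2 := Measure.map_apply_of_aemeasurable hL.aemeasurable hms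
  rw [h1] at h2
  change _ = P₀ {ω | |T₀ x ω - T₀ y ω| ≤ ε} at h2
  rw [← h2]
  have hpos := hv.trans_le hvar
  refine (gaussianReal_abs_le_le (Real.toNNReal_pos.2 hpos).ne' hε).trans ?_
  rw [Real.coe_toNNReal _ hpos.le]
  gcongr

/-- A small norm forces every coordinate to be small, and the coordinate events are independent with
the probability given by `T₀`. They involve two values of a path each, so the product σ-algebra
suffices. -/
theorem AreIndependentCopies.measure_norm_sub_le {d : ℕ} {T : Fin d → S2 → Ω → ℝ} {P : Measure Ω}
    {T₀ : S2 → Ω₀ → ℝ} {P₀ : Measure Ω₀} (h : AreIndependentCopies T P T₀ P₀) (x y : S2) (ε : ℝ) :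
    P {ω | ‖vectorField T x ω - vectorField T y ω‖ ≤ ε} ≤
      P₀ {ω | |T₀ x ω - T₀ y ω| ≤ ε} ^ d := by
  have hφ : Measurable fun f : S2 → ℝ => f x - f y :=
    (measurable_pi_apply x).sub (measurable_pi_apply y)
  have hms : MeasurableSet {r : ℝ | |r| ≤ ε} := measurableSet_le measurable_abs measurable_const
  have hms' : MeasurableSet {f : S2 → ℝ | |f x - f y| ≤ ε} := hφ hms
  have hind := h.indep.measure_inter_preimage_eq_mul Finset.univ
    (sets := fun _ => {f : S2 → ℝ | |f x - f y| ≤ ε}) (fun _ _ => hms')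
  have hid : ∀ i, P ((fun ω x => T i x ω) ⁻¹' {f : S2 → ℝ | |f x - f y| ≤ ε}) =
      P₀ {ω | |T₀ x ω - T₀ y ω| ≤ ε} := fun i => (h.identDistrib i).measure_mem_eq hms'
  simp_rw [hid] at hind
  rw [Finset.prod_const, Finset.card_univ, Fintype.card_fin] at hind
  rw [← hind]
  refine measure_mono fun ω hω => ?_
  simp only [mem_iInter]
  intro i _
  have h1 := PiLp.norm_apply_le (vectorField T x ω - vectorField T y ω) i
  rw [Real.norm_eq_abs] at h1
  exact h1.trans hω

/-! ### Integrals of kernels depending on the inner product -/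

theorem lintegral_coord {k : ℝ → ℝ≥0∞} (hk : Measurable k) :
    ∫⁻ z : S2, k (z.1 2) ∂areaMeasure =
      ENNReal.ofReal (2 * Real.pi) * ∫⁻ t in Icc (-1 : ℝ) 1, k t := by
  have hm : Measurable fun z : S2 => z.1 2 := by fun_prop
  rw [← lintegral_map hk hm, map_coord_areaMeasure, lintegral_smul_measure, smul_eq_mul]

theorem lintegral_inner {k : ℝ → ℝ≥0∞} (hk : Measurable k) (x : S2) :
    ∫⁻ z : S2, k ⟪x.1, z.1⟫_ℝ ∂areaMeasure =
      ENNReal.ofReal (2 * Real.pi) * ∫⁻ t in Icc (-1 : ℝ) 1, k t := by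
  obtain ⟨g, -, hg⟩ := exists_inner_eq_rotate x
  simp_rw [hg]
  have hm : Measurable fun z : S2 => k (z.1 2) := hk.comp (by fun_prop)
  rw [(measurePreserving_rotate g).lintegral_comp hm, lintegral_coord hk]

theorem lintegral_prod_inner {k : ℝ → ℝ≥0∞} (hk : Measurable k) :
    ∫⁻ q : S2 × S2, k ⟪q.1.1, q.2.1⟫_ℝ ∂areaMeasure.prod areaMeasure =
      ENNReal.ofReal (2 * Real.pi) * (∫⁻ t in Icc (-1 : ℝ) 1, k t) * areaMeasure univ := by
  have hm : Measurable fun q : S2 × S2 => k ⟪q.1.1, q.2.1⟫_ℝ := hk.comp (by fun_prop)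
  rw [lintegral_prod _ hm.aemeasurable]
  simp only [lintegral_inner hk, lintegral_const]

/-- Archimedes' theorem turns the exceptional pairs into the single height `t = 1`. Off them the
lower variance bound is positive. -/
theorem ae_inner_lt_one : ∀ᵐ q : S2 × S2 ∂areaMeasure.prod areaMeasure, ⟪q.1.1, q.2.1⟫_ℝ < 1 := by
  have hk : Measurable (indicator (Ici (1 : ℝ)) (1 : ℝ → ℝ≥0∞)) :=
    measurable_one.indicator measurableSet_Ici
  have hm : Measurable fun q : S2 × S2 => ⟪q.1.1, q.2.1⟫_ℝ := by fun_prop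
  have h1 := lintegral_prod_inner hk
  have h2 : ∫⁻ t in Icc (-1 : ℝ) 1, indicator (Ici (1 : ℝ)) (1 : ℝ → ℝ≥0∞) t = 0 := by
    rw [lintegral_indicator_one measurableSet_Ici, Measure.restrict_apply measurableSet_Ici]
    have : Ici (1 : ℝ) ∩ Icc (-1) 1 = {1} := by
      ext t
      simp only [mem_inter_iff, mem_Ici, mem_Icc, mem_singleton_iff]
      constructor
      · rintro ⟨h1, -, h2⟩
        linarith
      · rintro rfl
        norm_num
    rw [this, Real.volume_singleton]
  rw [h2, mul_zero, zero_mul] at h1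
  filter_upwards [(lintegral_eq_zero_iff (hk.comp hm)).1 h1] with q hq
  by_contra! hcon
  simp [hcon] at hq

/-- In `u = (1 - t)/2` the integrand is a multiple of `u^{-ad/2}`, with exponent above `-1`. -/
theorem lintegral_rpow_ne_top {c a : ℝ} (d : ℕ) (hc : 0 < c) (had : a * d < 2) :
    ∫⁻ t in Icc (-1 : ℝ) 1, ENNReal.ofReal (((√(c * ((1 - t) / 2) ^ a))⁻¹) ^ d) ≠ ∞ := by
  have hint : IntervalIntegrable (fun u : ℝ => u ^ (-(a / 2 * d))) volume 0 1 :=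
    intervalIntegral.intervalIntegrable_rpow' (by linarith)
  have h1 := (hint.comp_sub_left (1 / 2 : ℝ)).comp_mul_left (c := (1 / 2 : ℝ))
  norm_num at h1
  have h2 : IntegrableOn (fun t : ℝ => ((√(c * ((1 - t) / 2) ^ a))⁻¹) ^ d) (Icc (-1) 1) := by
    rw [integrableOn_Icc_iff_integrableOn_Ioc,
      ← intervalIntegrable_iff_integrableOn_Ioc_of_le (by norm_num)]
    refine (h1.symm.const_mul ((√c)⁻¹ ^ d)).congr fun t ht => ?_
    rw [uIoc_of_le (by norm_num)] at ht
    have hu : 0 ≤ (1 - t) / 2 := by linarith [ht.2]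
    have e : 1 / 2 - 1 / 2 * t = (1 - t) / 2 := by ring
    simp only [e]
    rw [Real.sqrt_mul hc.le, mul_inv, mul_pow, Real.sqrt_eq_rpow (((1 - t) / 2) ^ a),
      ← Real.rpow_mul hu, ← Real.rpow_neg hu, ← Real.rpow_mul_natCast hu]
    congr 2
    ring
  exact h2.lintegral_lt_top.ne

end SphericalField

/-! ### The main theorem -/

theorem mainTheorem4 {Ω Ω₀ : Type*} [MeasurableSpace Ω] [MeasurableSpace Ω₀]
    (P : Measure Ω) [IsProbabilityMeasure P] (P₀ : Measure Ω₀) [IsProbabilityMeasure P₀]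
    (d : ℕ) (α : ℝ)
    (T₀ : SphericalField.S2 → Ω₀ → ℝ) (T : Fin d → SphericalField.S2 → Ω → ℝ)
    (hT₀ : SphericalField.ConditionA T₀ P₀ α)
    (hT : SphericalField.AreIndependentCopies T P T₀ P₀)
    (hα : α < 4) (hβ : 0 < 4 - (α - 2) * (d : ℝ)) :
    ∀ᵐ ω ∂P,
      NullMeasurableSet (Set.range fun x => SphericalField.vectorField T x ω)
          (volume : Measure (EuclideanSpace ℝ (Fin d))) ∧
        0 < (volume : Measure (EuclideanSpace ℝ (Fin d)))
          (Set.range fun x => SphericalField.vectorField T x ω) := by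
  open SphericalField InnerProductSpace in
  choose S hS hTS using hT.measurable
  -- The null event does not depend on `x`, so almost surely the ranges of the two fields coincide.
  have hae : ∀ᵐ ω ∂P, ∀ x, vectorField T x ω = vectorField S x ω := by
    filter_upwards [ae_all_iff.2 hTS] with ω hω x
    simp only [vectorField, hω]
  have hmeas : Measurable fun q : S2 × Ω => vectorField S q.1 q.2 :=
    (WithLp.measurable_toLp 2 (Fin d → ℝ)).comp (measurable_pi_lambda _ hS)
  obtain ⟨c, hc, hvar⟩ := hT₀.exists_rpow_le_variance hα
  set a := (α - 2) / 2 with ha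
  let k : ℝ → ℝ≥0∞ := fun t => ENNReal.ofReal (((√(c * ((1 - t) / 2) ^ a))⁻¹) ^ d)
  have hk : Measurable k := by fun_prop
  have hkint : ∫⁻ q : S2 × S2, k ⟪q.1.1, q.2.1⟫_ℝ ∂areaMeasure.prod areaMeasure ≠ ∞ := by
    rw [lintegral_prod_inner hk]
    refine ENNReal.mul_ne_top (ENNReal.mul_ne_top ENNReal.ofReal_ne_top ?_) (measure_ne_top _ _)
    -- Here `β > 0` enters, as `(α - 2)/2 · d < 2`.
    exact lintegral_rpow_ne_top d hc (by rw [ha]; linarith)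
  have hpos := ae_measure_range_pos_of_smallBall (ν := areaMeasure) (P := P)
    (volume : Measure (EuclideanSpace ℝ (Fin d))) hmeas
    (g := fun q => k ⟪q.1.1, q.2.1⟫_ℝ) (hk.comp (by fun_prop)) hkint (by
      filter_upwards [ae_inner_lt_one] with q hq ε hε
      have hcongr : P {ω | ‖vectorField S q.1 ω - vectorField S q.2 ω‖ ≤ ε} =
          P {ω | ‖vectorField T q.1 ω - vectorField T q.2 ω‖ ≤ ε} := by
        refine measure_congr ?_
        filter_upwards [hae] with ω hω
        apply propext
        change ‖_ - _‖ ≤ ε ↔ ‖_ - _‖ ≤ ε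
        rw [hω, hω]
      have hv : 0 < c * ((1 - ⟪q.1.1, q.2.1⟫_ℝ) / 2) ^ a :=
        mul_pos hc (Real.rpow_pos_of_pos (by linarith) _)
      rw [hcongr, finrank_euclideanSpace_fin]
      refine (hT.measure_norm_sub_le q.1 q.2 ε).trans ?_
      refine (pow_le_pow_left' (hT₀.measure_abs_sub_le hv (hvar q.1 q.2) hε) d).trans_eq ?_
      simp only [k]
      rw [← ENNReal.ofReal_pow (by positivity), mul_pow, ENNReal.ofReal_mul (by positivity)])
  filter_upwards [hae, hpos] with ω hω hω'
  simp only [hω]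
  exact ⟨nullMeasurableSet_range_of_measurable
    (hmeas.comp (measurable_id.prodMk measurable_const)) _, hω'⟩
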